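/- **Setting.** Let $X$ be a compact connected Riemann surface with canonical line bundle $K$. An $\mathrm{Sp}(2p,2q)$-Higgs bundle $(V,\Omega_V,W,\Omega_W,\beta,\gamma)$ on $X$ consists of holomorphic symplectic vector bundles $(V,\Omega_V)$ and $(W,\Omega_W)$ of ranks $2p$ and $2q$, and holomorphic maps $\beta:W\to V\otimes K$, $\gamma:V\to W\otimes K$ with $\Omega_V(\beta\,\cdot,\cdot)=-\Omega_W(\cdot,\gamma\,\cdot)$. A $\mathrm{U}(p,q)$-Higgs bundle $(V',W',\beta',\gamma')$ consists of holomorphic vector bundles $V',W'$ of ranks $p,q$ and holomorphic maps $\beta':W'\to V'\otimes K$, $\gamma':V'\to W'\otimes K$. An $\mathrm{Sp}(2n)$-Higgs bundle is a holomorphic symplectic vector bundle of rank $2n$, and a $\mathrm{U}(n)$-Higgs bundle is a holomorphic vector bundle of rank $n$ (both with zero Higgs field). A pair of holomorphic subbundles $V'\subseteq V$, $W'\subseteq W$ is called invariant if $\beta(W')\subseteq V'\otimes K$ and $\gamma(V')\subseteq W'\otimes K$; it is called isotropic (coisotropic) if both $V'$ and $W'$ are, and complementary to $(V'',W'')$ if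 $V=V'\oplus V''$ and $W=W'\oplus W''$. * An $\mathrm{Sp}(2p,2q)$-Higgs bundle is *semistable* if $\deg V'+\deg W'\le 0$ for every invariant isotropic pair; *stable* if $\deg V'+\deg W'<0$ for every invariant isotropic pair other than $(0,0)$; *polystable* if it is semistable and every invariant isotropic (resp. coisotropic) pair with $\deg V'+\deg W'=0$ has a complementary invariant coisotropic (resp. isotropic) pair. * A $\mathrm{U}(p,q)$-Higgs bundle is *stable* if every invariant pair of subbundles, other than the zero pair and the whole, has slope $(\deg+\deg)/(\mathrm{rk}+\mathrm{rk})$ strictly smaller than the slope of the whole. A $\mathrm{U}(n)$-Higgs bundle is stable if it is a (slope-)stable vector bundle. An $\mathrm{Sp}(2n)$-Higgs bundle is stable if every nonzero isotropic subbundle has negative degree. * A $\mathrm{U}(p,q)$-Higgs bundle $(V',W',\beta',\gamma')$ induces, through $\mathrm{U}(p,q)\subset\mathrm{Sp}(2p,2q)$, the $\mathrm{Sp}(2p,2q)$-Higgs bundle $V=V'\oplus V'^*$, $W=W'\oplus W'^*$ with the standard symplectic forms, $\beta=\beta'\oplus(-\gamma'^t)$ and $\gamma=\gamma'\oplus(-\beta'^t)$.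 An $\mathrm{Sp}(2n)$-Higgs bundle induces an $\mathrm{Sp}(2n,0)$- or an $\mathrm{Sp}(0,2n)$-Higgs bundle, by putting it in the place of $V$ or of $W$, the other bundle being $0$; a $\mathrm{U}(n)$-Higgs bundle $E$ does so through $E\oplus E^*$ with its standard symplectic form. **Theorem.** Every polystable $\mathrm{Sp}(2p,2q)$-Higgs bundle on $X$ is isomorphic to a finite (orthogonal) direct sum of nonzero $\mathrm{Sp}(2a_\alpha,2b_\alpha)$-Higgs bundles, each of which is (isomorphic to one) induced by a stable $G_\alpha$-Higgs bundle, where each $G_\alpha$ is one of $\mathrm{Sp}(2p_\alpha,2q_\alpha)$, $\mathrm{U}(p_\alpha,q_\alpha)$, $\mathrm{Sp}(2n_\alpha)$ or $\mathrm{U}(n_\alpha)$ with $p_\alpha\le p$, $q_\alpha\le q$ and $n_\alpha\le p+q$. The $\mathrm{U}(p_\alpha,q_\alpha)$- and $\mathrm{U}(n_\alpha)$-Higgs bundles that occur have total degree $0$. -/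

import Mathlib

open scoped Manifold ContDiff Topology Bundle
open Module

universe u v w

/-! Holomorphic bundles and Higgs bundles on a Riemann surface `X`, i.e. a one-dimensional complex
analytic manifold modelled on `ℂ`.  Analytic over `ℂ` (`ω`) is the same as holomorphic. -/

namespace HiggsBundles

noncomputable section

/-- A holomorphic vector bundle `A` on `X`: a bundled version of Mathlib's analytic vector bundles,
with model fibre `A.F` of finite dimension and with fibres `A.Fib x`. -/
structure HolBundle (X : Type u) [TopologicalSpace X] [ChartedSpace ℂ X] where
  F : Type v
  Fib : X → Type v
  [normedF : NormedAddCommGroup F]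
  [spaceF : NormedSpace ℂ F]
  [finiteF : FiniteDimensional ℂ F]
  [addFib : ∀ x, AddCommGroup (Fib x)]
  [modFib : ∀ x, Module ℂ (Fib x)]
  [topFib : ∀ x, TopologicalSpace (Fib x)]
  [topTotal : TopologicalSpace (Bundle.TotalSpace F Fib)]
  [fibre : FiberBundle F Fib]
  [vector : VectorBundle ℂ F Fib]
  [holomorphic : ContMDiffVectorBundle ω F Fib 𝓘(ℂ)]

attribute [instance] HolBundle.normedF HolBundle.spaceF HolBundle.finiteF HolBundle.addFib
  HolBundle.modFib HolBundle.topFib HolBundle.topTotal HolBundle.fibre HolBundle.vector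
  HolBundle.holomorphic

variable {X : Type u} [TopologicalSpace X] [ChartedSpace ℂ X]

namespace HolBundle

/-- The rank of a holomorphic vector bundle. -/
def rank (A : HolBundle.{u, v} X) : ℕ := finrank ℂ A.F

/-- The section `s` of `A` is holomorphic on `U`. -/
def IsHolOn (A : HolBundle.{u, v} X) (U : Set X) (s : ∀ x, A.Fib x) : Prop :=
  ContMDiffOn 𝓘(ℂ) (𝓘(ℂ).prod 𝓘(ℂ, A.F)) ω
    (fun x => (Bundle.TotalSpace.mk' A.F x (s x) : Bundle.TotalSpace A.F A.Fib)) U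

/-- A fibre is linearly homeomorphic to the model fibre. -/
def fibreEquiv (A : HolBundle.{u, v} X) (x : X) : A.Fib x ≃L[ℂ] A.F :=
  (trivializationAt A.F A.Fib x).continuousLinearEquivAt ℂ x
    (FiberBundle.mem_baseSet_trivializationAt' x)

/-- The direct sum of two holomorphic vector bundles. -/
def prod (A : HolBundle.{u, v} X) (B : HolBundle.{u, w} X) : HolBundle.{u, max v w} X where
  F := A.F × B.F
  Fib := fun x => A.Fib x × B.Fib x

/-- The dual of a holomorphic vector bundle. -/
def dual (A : HolBundle.{u, v} X) : HolBundle.{u, v} X where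
  F := A.F →L[ℂ] ℂ
  Fib := fun x => A.Fib x →L[ℂ] Bundle.Trivial X ℂ x

instance (A : HolBundle.{u, v} X) (x : X) : IsTopologicalAddGroup (A.Fib x) :=
  (A.fibreEquiv x).toHomeomorph.isInducing.topologicalAddGroup (A.fibreEquiv x)

instance (A : HolBundle.{u, v} X) (x : X) : ContinuousSMul ℂ (A.Fib x) :=
  (A.fibreEquiv x).toHomeomorph.isInducing.continuousSMul continuous_id
    (fun {c v} => (A.fibreEquiv x).map_smul c v)

instance (A : HolBundle.{u, v} X) (x : X) : T2Space (A.Fib x) :=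
  (A.fibreEquiv x).toHomeomorph.symm.t2Space

instance (A : HolBundle.{u, v} X) (x : X) : FiniteDimensional ℂ (A.Fib x) :=
  (A.fibreEquiv x).toLinearEquiv.symm.finiteDimensional

end HolBundle

/-- A holomorphic homomorphism of vector bundles. -/
structure HolHom (A : HolBundle.{u, v} X) (B : HolBundle.{u, w} X) where
  toFun : ∀ x, A.Fib x →ₗ[ℂ] B.Fib x
  hol : ∀ (U : Set X) (s : ∀ x, A.Fib x), IsOpen U → A.IsHolOn U s →
    B.IsHolOn U (fun x => toFun x (s x))

/-- A holomorphic isomorphism of vector bundles (the inverse of a holomorphic homomorphism that is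
bijective on the fibres is holomorphic). -/
structure HolIso (A : HolBundle.{u, v} X) (B : HolBundle.{u, w} X) extends HolHom A B where
  bijective : ∀ x, Function.Bijective (toFun x)

/-- The local vector field `t` on `X` is holomorphic on `U`. -/
def IsHolVectorFieldOn [IsManifold 𝓘(ℂ) ω X] (U : Set X)
    (t : ∀ x : X, TangentSpace 𝓘(ℂ) x) : Prop :=
  ContMDiffOn 𝓘(ℂ) 𝓘(ℂ).tangent ω (fun x => (⟨x, t x⟩ : TangentBundle 𝓘(ℂ) X)) U

/-- A `K`-twisted homomorphism `A → B ⊗ K`, where `K` is the canonical line bundle.  As `K` is the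
dual of the holomorphic tangent line bundle `T`, this is a holomorphic section of
`Hom(T, Hom(A, B)) = Hom(A, B) ⊗ K`. -/
structure TwistedHom [IsManifold 𝓘(ℂ) ω X] (A : HolBundle.{u, v} X) (B : HolBundle.{u, w} X) where
  toFun : ∀ x : X, TangentSpace 𝓘(ℂ) x →ₗ[ℂ] A.Fib x →ₗ[ℂ] B.Fib x
  hol : ∀ (U : Set X) (t : ∀ x : X, TangentSpace 𝓘(ℂ) x) (s : ∀ x, A.Fib x), IsOpen U →
    IsHolVectorFieldOn U t → A.IsHolOn U s → B.IsHolOn U (fun x => toFun x (t x) (s x))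

/-- A holomorphic symplectic form on a holomorphic vector bundle. -/
structure SymplecticForm (A : HolBundle.{u, v} X) where
  form : ∀ x, A.Fib x →ₗ[ℂ] A.Fib x →ₗ[ℂ] ℂ
  alternating : ∀ x a, form x a a = 0
  nondegenerate : ∀ x a, (∀ b, form x a b = 0) → a = 0
  hol : ∀ (U : Set X) (s t : ∀ x, A.Fib x), IsOpen U → A.IsHolOn U s → A.IsHolOn U t →
    ContMDiffOn 𝓘(ℂ) 𝓘(ℂ) ω (fun x => form x (s x) (t x)) U

/-! ### Subbundles and degree -/

/-- `e` is a holomorphic frame on `U` of the family of subspaces `S`. -/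
def IsFrameOn (A : HolBundle.{u, v} X) (S : ∀ x, Submodule ℂ (A.Fib x)) {r : ℕ} (U : Set X)
    (e : Fin r → ∀ x, A.Fib x) : Prop :=
  (∀ i, A.IsHolOn U (e i)) ∧
    ∀ x ∈ U, LinearIndependent ℂ (fun i => e i x) ∧
      Submodule.span ℂ (Set.range fun i => e i x) = S x

/-- A holomorphic vector subbundle: a family of subspaces with local holomorphic frames. -/
structure HolSubbundle (A : HolBundle.{u, v} X) where
  fib : ∀ x, Submodule ℂ (A.Fib x)
  rank : ℕ
  locallyFree : ∀ x₀, ∃ U : Set X, IsOpen U ∧ x₀ ∈ U ∧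
    ∃ e : Fin rank → ∀ x, A.Fib x, IsFrameOn A fib U e

namespace HolSubbundle

variable {A : HolBundle.{u, v} X}

/-- `d` is the degree of the determinant of `S`, computed from a meromorphic frame `s` of `S`
(a frame away from finitely many points): `d = ∑ₓ ordₓ (s₁ ∧ … ∧ sᵣ)`.  Here the order at `x₀` is
that of `det a`, where `s = e a` near `x₀` with `e` a local holomorphic frame of `S` and `a` a matrix
of meromorphic functions. -/
def HasDegree (S : HolSubbundle A) (d : ℤ) : Prop :=
  ∃ (s : Fin S.rank → ∀ x, A.Fib x) (ord : X → ℤ),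
    (∀ x₀, ∃ U : Set X, IsOpen U ∧ x₀ ∈ U ∧
      ∃ (e : Fin S.rank → ∀ x, A.Fib x) (a : X → Matrix (Fin S.rank) (Fin S.rank) ℂ),
        IsFrameOn A S.fib U e ∧
        (∀ᶠ x in 𝓝[≠] x₀, ∀ j, s j x = ∑ i, a x i j • e i x) ∧
        (∀ i j, MeromorphicAt (fun z => a ((chartAt ℂ x₀).symm z) i j) (chartAt ℂ x₀ x₀)) ∧
        meromorphicOrderAt (fun z => (a ((chartAt ℂ x₀).symm z)).det) (chartAt ℂ x₀ x₀)
          = (ord x₀ : WithTop ℤ)) ∧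
    ord.support.Finite ∧ d = ∑ᶠ x, ord x

open Classical in
/-- The degree of a subbundle.  On a compact Riemann surface every holomorphic vector bundle has
a meromorphic frame, and all of them give the same number. -/
def degree (S : HolSubbundle A) : ℤ :=
  if h : ∃ d, S.HasDegree d then h.choose else 0

/-- The whole bundle, as a subbundle of itself. -/
def whole (A : HolBundle.{u, v} X) : HolSubbundle A where
  fib := fun _ => ⊤
  rank := A.rank
  locallyFree := by
    intro x₀
    have := (inferInstance : ContMDiffVectorBundle ω A.F A.Fib 𝓘(ℂ))
    let t := trivializationAt A.F A.Fib x₀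
    have h := t.isLocalFrameOn_localFrame_baseSet 𝓘(ℂ) ω (finBasis ℂ A.F)
    exact ⟨t.baseSet, t.open_baseSet, FiberBundle.mem_baseSet_trivializationAt' x₀,
      t.localFrame (finBasis ℂ A.F), fun i => h.contMDiffOn i,
      fun x hx => ⟨h.linearIndependent hx, top_le_iff.mp (h.generating hx)⟩⟩

/-- `S` is isotropic: the form vanishes on it. -/
def IsIsotropic (Ω : SymplecticForm A) (S : HolSubbundle A) : Prop :=
  ∀ x, ∀ a ∈ S.fib x, ∀ b ∈ S.fib x, Ω.form x a b = 0

/-- `S` is coisotropic: it contains its orthogonal complement. -/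
def IsCoisotropic (Ω : SymplecticForm A) (S : HolSubbundle A) : Prop :=
  ∀ x a, (∀ b ∈ S.fib x, Ω.form x a b = 0) → a ∈ S.fib x

/-- `A = S ⊕ T`. -/
def IsComplement (S T : HolSubbundle A) : Prop := ∀ x, IsCompl (S.fib x) (T.fib x)

end HolSubbundle

/-- The degree of a holomorphic vector bundle. -/
def HolBundle.degree (A : HolBundle.{u, v} X) : ℤ := (HolSubbundle.whole A).degree

/-! ### Higgs bundles for the noncompact groups -/

section Higgs

variable [IsManifold 𝓘(ℂ) ω X]

/-- A `U(p,q)`-Higgs bundle `(V, W, β, γ)`. -/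
structure UHiggs (X : Type u) [TopologicalSpace X] [ChartedSpace ℂ X] [IsManifold 𝓘(ℂ) ω X]
    (p q : ℕ) where
  V : HolBundle.{u, v} X
  W : HolBundle.{u, v} X
  rankV : V.rank = p
  rankW : W.rank = q
  β : TwistedHom W V
  γ : TwistedHom V W

/-- An `Sp(2p,2q)`-Higgs bundle `(V, Ω_V, W, Ω_W, β, γ)`. -/
structure SpHiggs (X : Type u) [TopologicalSpace X] [ChartedSpace ℂ X] [IsManifold 𝓘(ℂ) ω X]
    (p q : ℕ) extends UHiggs.{u, v} X (2 * p) (2 * q) where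
  ΩV : SymplecticForm V
  ΩW : SymplecticForm W
  skew : ∀ x t w a, ΩV.form x (β.toFun x t w) a = -ΩW.form x w (γ.toFun x t a)

namespace UHiggs

variable {p q : ℕ}

/-- Invariance of `V' ⊕ W'` under the Higgs field: `β(W') ⊆ V' ⊗ K` and `γ(V') ⊆ W' ⊗ K`. -/
def IsInvariant (H : UHiggs.{u, v} X p q) (V' : HolSubbundle H.V) (W' : HolSubbundle H.W) : Prop :=
  ∀ x t, (∀ w ∈ W'.fib x, H.β.toFun x t w ∈ V'.fib x) ∧
    ∀ a ∈ V'.fib x, H.γ.toFun x t a ∈ W'.fib x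

/-- The degree of `V ⊕ W`. -/
def degree (H : UHiggs.{u, v} X p q) : ℤ := H.V.degree + H.W.degree

/-- Slope stability: every proper nonzero invariant `V' ⊕ W'` has slope less than that of
`V ⊕ W` (with denominators cleared). -/
def IsStable (H : UHiggs.{u, v} X p q) : Prop :=
  ∀ (V' : HolSubbundle H.V) (W' : HolSubbundle H.W), H.IsInvariant V' W' →
    0 < V'.rank + W'.rank → V'.rank + W'.rank < p + q →
    (V'.degree + W'.degree) * ((p + q : ℕ) : ℤ) < H.degree * ((V'.rank + W'.rank : ℕ) : ℤ)

end UHiggs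

namespace SpHiggs

variable {p q : ℕ}

/-- Semistability: invariant isotropic `V' ⊕ W'` have degree at most `0`. -/
def IsSemistable (H : SpHiggs.{u, v} X p q) : Prop :=
  ∀ (V' : HolSubbundle H.V) (W' : HolSubbundle H.W), V'.IsIsotropic H.ΩV → W'.IsIsotropic H.ΩW →
    H.IsInvariant V' W' → V'.degree + W'.degree ≤ 0

/-- Stability: nonzero invariant isotropic `V' ⊕ W'` have negative degree. -/
def IsStable (H : SpHiggs.{u, v} X p q) : Prop :=
  ∀ (V' : HolSubbundle H.V) (W' : HolSubbundle H.W), V'.IsIsotropic H.ΩV → W'.IsIsotropic H.ΩW →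
    H.IsInvariant V' W' → 0 < V'.rank + W'.rank → V'.degree + W'.degree < 0

/-- Polystability: semistability, and every invariant isotropic (resp. coisotropic) `V' ⊕ W'` of
degree `0` has an invariant coisotropic (resp. isotropic) complement `V'' ⊕ W''`.  (The trivial
pairs `V' = 0, W' = 0`, resp. `V' = V, W' = W`, need no exclusion: they have the complement
`V, W`, resp. `0, 0`.) -/
def IsPolystable (H : SpHiggs.{u, v} X p q) : Prop :=
  H.IsSemistable ∧
  (∀ (V' : HolSubbundle H.V) (W' : HolSubbundle H.W), V'.IsIsotropic H.ΩV → W'.IsIsotropic H.ΩW →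
    H.IsInvariant V' W' → V'.degree + W'.degree = 0 →
    ∃ (V'' : HolSubbundle H.V) (W'' : HolSubbundle H.W),
      V''.IsCoisotropic H.ΩV ∧ W''.IsCoisotropic H.ΩW ∧ H.IsInvariant V'' W'' ∧
        V'.IsComplement V'' ∧ W'.IsComplement W'') ∧
  (∀ (V' : HolSubbundle H.V) (W' : HolSubbundle H.W),
    V'.IsCoisotropic H.ΩV → W'.IsCoisotropic H.ΩW →
    H.IsInvariant V' W' → V'.degree + W'.degree = 0 →
    ∃ (V'' : HolSubbundle H.V) (W'' : HolSubbundle H.W),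
      V''.IsIsotropic H.ΩV ∧ W''.IsIsotropic H.ΩW ∧ H.IsInvariant V'' W'' ∧
        V'.IsComplement V'' ∧ W'.IsComplement W'')

/-- `H` is isomorphic to the direct sum of the `Sp`-Higgs bundles `G i`: there are holomorphic
homomorphisms `f i : V_i → V` and `g i : W_i → W` such that `∑ f i : ⨁ V_i → V` and
`∑ g i : ⨁ W_i → W` are isomorphisms, the symplectic forms of `H` are the orthogonal sums of those
of the `G i`, and the Higgs field of `H` is the direct sum of those of the `G i`. -/
def IsDirectSum (H : SpHiggs.{u, v} X p q) {N : ℕ} {a b : Fin N → ℕ}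
    (G : ∀ i, SpHiggs.{u, w} X (a i) (b i)) : Prop :=
  ∃ (f : ∀ i, HolHom (G i).V H.V) (g : ∀ i, HolHom (G i).W H.W),
    (∀ x, Function.Bijective fun c : (∀ i, (G i).V.Fib x) => ∑ i, (f i).toFun x (c i)) ∧
    (∀ x, Function.Bijective fun c : (∀ i, (G i).W.Fib x) => ∑ i, (g i).toFun x (c i)) ∧
    (∀ x (c c' : ∀ i, (G i).V.Fib x),
      H.ΩV.form x (∑ i, (f i).toFun x (c i)) (∑ i, (f i).toFun x (c' i))
        = ∑ i, (G i).ΩV.form x (c i) (c' i)) ∧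
    (∀ x (c c' : ∀ i, (G i).W.Fib x),
      H.ΩW.form x (∑ i, (g i).toFun x (c i)) (∑ i, (g i).toFun x (c' i))
        = ∑ i, (G i).ΩW.form x (c i) (c' i)) ∧
    (∀ x t i (c : (G i).W.Fib x),
      H.β.toFun x t ((g i).toFun x c) = (f i).toFun x ((G i).β.toFun x t c)) ∧
    (∀ x t i (c : (G i).V.Fib x),
      H.γ.toFun x t ((f i).toFun x c) = (g i).toFun x ((G i).γ.toFun x t c))

end SpHiggs

end Higgs

/-! ### Extension of the structure group -/

/-- The evaluation pairing of `A*` with `A`. -/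
def eval {A : HolBundle.{u, v} X} {x : X} (ξ : A.dual.Fib x) (c : A.Fib x) : ℂ :=
  DFunLike.coe (F := A.Fib x →L[ℂ] ℂ) ξ c

/-- The negative transpose `-gᵗ` of a linear map between fibres. -/
def negTranspose {A : HolBundle.{u, v} X} {B : HolBundle.{u, w} X} {x : X}
    (g : A.Fib x →ₗ[ℂ] B.Fib x) (ξ : B.dual.Fib x) : A.dual.Fib x :=
  -(ContinuousLinearMap.comp (M₃ := ℂ) ξ (LinearMap.toContinuousLinearMap g) : A.Fib x →L[ℂ] ℂ)

theorem eval_negTranspose {A : HolBundle.{u, v} X} {B : HolBundle.{u, w} X} {x : X}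
    (g : A.Fib x →ₗ[ℂ] B.Fib x) (ξ : B.dual.Fib x) (c : A.Fib x) :
    eval (negTranspose g ξ) c = -eval ξ (g c) := rfl

/-- The standard symplectic form `⟨(a, ξ), (b, η)⟩ = η(a) - ξ(b)` on `A ⊕ A*`. -/
def standardForm (A : HolBundle.{u, v} X) (x : X) (c c' : (A.prod A.dual).Fib x) : ℂ :=
  eval c'.2 c.1 - eval c.2 c'.1

/-- `(B, Ω)` is isomorphic to `A ⊕ A*` with its standard symplectic form. -/
def IsDouble (A : HolBundle.{u, v} X) {B : HolBundle.{u, w} X} (Ω : SymplecticForm B) : Prop :=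
  ∃ f : HolIso (A.prod A.dual) B,
    ∀ x c c', Ω.form x (f.toFun x c) (f.toFun x c') = standardForm A x c c'

/-- `G` is isomorphic to the `Sp(2p,2q)`-Higgs bundle
`(V ⊕ V*, ⟨ , ⟩, W ⊕ W*, ⟨ , ⟩, β - γᵗ, γ - βᵗ)` that the `U(p,q)`-Higgs bundle `H = (V, W, β, γ)`
defines through the inclusion of `U(p,q)` in `Sp(2p,2q)`. -/
def UHiggs.Induces [IsManifold 𝓘(ℂ) ω X] {p q : ℕ} (H : UHiggs.{u, v} X p q)
    (G : SpHiggs.{u, w} X p q) : Prop :=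
  ∃ (f : HolIso (H.V.prod H.V.dual) G.V) (g : HolIso (H.W.prod H.W.dual) G.W),
    (∀ x c c', G.ΩV.form x (f.toFun x c) (f.toFun x c') = standardForm H.V x c c') ∧
    (∀ x c c', G.ΩW.form x (g.toFun x c) (g.toFun x c') = standardForm H.W x c c') ∧
    (∀ x t (c : (H.W.prod H.W.dual).Fib x), G.β.toFun x t (g.toFun x c) =
      f.toFun x (H.β.toFun x t c.1, negTranspose (H.γ.toFun x t) c.2)) ∧
    (∀ x t (c : (H.V.prod H.V.dual).Fib x), G.γ.toFun x t (f.toFun x c) =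
      g.toFun x (H.γ.toFun x t c.1, negTranspose (H.β.toFun x t) c.2))

/-- An `Sp(2n)`-Higgs bundle.  As `Sp(2n)` is compact, there is no Higgs field: this is
a holomorphic symplectic vector bundle of rank `2n`. -/
structure CompactSpHiggs (X : Type u) [TopologicalSpace X] [ChartedSpace ℂ X] (n : ℕ) where
  E : HolBundle.{u, v} X
  rankE : E.rank = 2 * n
  Ω : SymplecticForm E

namespace CompactSpHiggs

variable {n : ℕ}

/-- Stability: nonzero isotropic subbundles have negative degree. -/
def IsStable (F : CompactSpHiggs.{u, v} X n) : Prop :=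
  ∀ E' : HolSubbundle F.E, E'.IsIsotropic F.Ω → 0 < E'.rank → E'.degree < 0

/-- `(B, Ω)` is isomorphic to the symplectic bundle `F`. -/
def IsIsometric (F : CompactSpHiggs.{u, v} X n) {B : HolBundle.{u, w} X} (Ω : SymplecticForm B) :
    Prop :=
  ∃ f : HolIso F.E B, ∀ x c c', Ω.form x (f.toFun x c) (f.toFun x c') = F.Ω.form x c c'

/-- `G` is the `Sp`-Higgs bundle defined by `F` through `Sp(2n) = Sp(2n,0)` or `Sp(2n) = Sp(0,2n)`.
Its Higgs field is `0`, as one of its two bundles is. -/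
def Induces [IsManifold 𝓘(ℂ) ω X] (F : CompactSpHiggs.{u, v} X n) {a b : ℕ}
    (G : SpHiggs.{u, w} X a b) : Prop :=
  (a = n ∧ b = 0 ∧ F.IsIsometric G.ΩV) ∨ (a = 0 ∧ b = n ∧ F.IsIsometric G.ΩW)

end CompactSpHiggs

/-- A `U(n)`-Higgs bundle.  As `U(n)` is compact, there is no Higgs field: this is a holomorphic
vector bundle of rank `n`. -/
structure CompactUHiggs (X : Type u) [TopologicalSpace X] [ChartedSpace ℂ X] (n : ℕ) where
  E : HolBundle.{u, v} X
  rankE : E.rank = n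

namespace CompactUHiggs

variable {n : ℕ}

/-- Slope stability (with denominators cleared). -/
def IsStable (F : CompactUHiggs.{u, v} X n) : Prop :=
  ∀ E' : HolSubbundle F.E, 0 < E'.rank → E'.rank < n →
    E'.degree * (n : ℤ) < F.E.degree * (E'.rank : ℤ)

/-- `G` is the `Sp`-Higgs bundle defined by `F` through `U(n) ⊆ Sp(2n)` and `Sp(2n) = Sp(2n,0)` or
`Sp(2n) = Sp(0,2n)`: its nonzero bundle is `E ⊕ E*`.  Its Higgs field is `0`. -/
def Induces [IsManifold 𝓘(ℂ) ω X] (F : CompactUHiggs.{u, v} X n) {a b : ℕ}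
    (G : SpHiggs.{u, w} X a b) : Prop :=
  (a = n ∧ b = 0 ∧ IsDouble F.E G.ΩV) ∨ (a = 0 ∧ b = n ∧ IsDouble F.E G.ΩW)

end CompactUHiggs

end
end HiggsBundles

/-!
A polystable `Sp(2p,2q)`-Higgs bundle `H` is decomposed by splitting off orthogonal summands, each
of which is described by a self-adjoint idempotent pair of holomorphic endomorphisms of `V` and `W`
that commutes with the Higgs field (`SpHiggs.IsSummandProj`).

Let `R` be such a projection.  If its range contains no nonzero invariant isotropic pair of degree
`0`, then by semistability all those pairs have negative degree, and the range of `R` is stable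
(`SpHiggs.IsSummandProj.isStable_range`).  Otherwise let `(S, T)` be such a pair, of minimal rank.
Its proper nonzero invariant subpairs are isotropic, so they have degree at most `0`, and by
minimality not `0`: the `U(a,b)`-Higgs bundle that `H` induces on `(S, T)` is stable of degree `0`
(`SpHiggs.IsZeroPair.isStable_restrict`).

Polystability provides an invariant complement, and the projection along it, composed with `R`, is
a holomorphic projection `P` onto `(S, T)` that commutes with the Higgs field and satisfies
`R P = P = P R`.  As the range of `P` is isotropic, its adjoint satisfies `P† P = 0`, and
`Q = P + P† - P P†` is a self-adjoint idempotent (`SpHiggs.doubleProj`).  Its range is the double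
`(S ⊕ S*, T ⊕ T*)` with the standard forms: the embedding of `S*` sends `ξ` to `(1 - P/2) (ξ ∘ P)♯`,
where `♯` turns functionals into vectors through the symplectic form, and the correction by `-P/2`
makes its image isotropic.  So `Q` splits off a summand induced by a stable `U(a,b)`-Higgs bundle,
and the induction goes on with `R - Q`, of smaller rank.  As all subbundles are taken inside `H`,
no inheritance of polystability by the summands is needed.

The degree enters only through the fact that a subbundle of a subbundle has the same degree in both
(`HolSubbundle.degree_push`), because the meromorphic frames that compute it are the same.

The analytic part makes subbundles into bundles (`HolSubbundle.toBundle`) and shows that adjoints,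
projections along complements and images of constant rank are holomorphic.  All of it rests on
`contMDiffAt_of_injective_apply`: the solution of a linear system with holomorphic coefficients is
holomorphic where the system is injective.
-/

namespace HiggsBundles

noncomputable section

/-! ### Holomorphic sections at a point -/

section Sections

variable {X : Type u} [TopologicalSpace X] [ChartedSpace ℂ X]

/-- The section `s` of `A` is holomorphic near `x₀`.  As analyticity at a point is an open
condition, this only asks for analyticity at `x₀` itself. -/
def HolBundle.HolAt (A : HolBundle.{u, v} X) (s : ∀ x, A.Fib x) (x₀ : X) : Prop :=
  ContMDiffAt 𝓘(ℂ) (𝓘(ℂ).prod 𝓘(ℂ, A.F)) ω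
    (fun x => (Bundle.TotalSpace.mk' A.F x (s x) : Bundle.TotalSpace A.F A.Fib)) x₀

namespace HolBundle

variable {A : HolBundle.{u, v} X}

theorem isHolOn_iff_holAt {U : Set X} (hU : IsOpen U) {s : ∀ x, A.Fib x} :
    A.IsHolOn U s ↔ ∀ x ∈ U, A.HolAt s x :=
  ⟨fun h x hx => (h x hx).contMDiffAt (hU.mem_nhds hx),
    fun h x hx => (h x hx).contMDiffWithinAt⟩

variable (A) in
/-- The fibre of `A` at `x`, read in the preferred trivialization around `x₀`. -/
def read (x₀ x : X) : A.Fib x →L[ℂ] A.F :=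
  (trivializationAt A.F A.Fib x₀).continuousLinearMapAt ℂ x

theorem read_injective (x₀ : X) : Function.Injective (A.read x₀ x₀) := by
  have h := (A.fibreEquiv x₀).injective
  convert h using 1
  ext v
  simp [read, fibreEquiv, FiberBundle.mem_baseSet_trivializationAt']

theorem holAt_iff_read {s : ∀ x, A.Fib x} {x₀ : X} :
    A.HolAt s x₀ ↔ ContMDiffAt 𝓘(ℂ) 𝓘(ℂ, A.F) ω (fun x => A.read x₀ x (s x)) x₀ := by
  rw [HolAt, Bundle.contMDiffAt_section]
  have h : (fun x => A.read x₀ x (s x)) =ᶠ[𝓝 x₀]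
      fun x => (trivializationAt A.F A.Fib x₀ ⟨x, s x⟩).2 := by
    filter_upwards [(trivializationAt A.F A.Fib x₀).open_baseSet.mem_nhds
      (FiberBundle.mem_baseSet_trivializationAt' x₀)] with x hx
    simp [read, hx]
  exact ⟨fun H => H.congr_of_eventuallyEq h, fun H => H.congr_of_eventuallyEq h.symm⟩

theorem HolAt.congr {s s' : ∀ x, A.Fib x} {x₀ : X} (h : A.HolAt s x₀)
    (hs : ∀ᶠ x in 𝓝 x₀, s' x = s x) : A.HolAt s' x₀ :=
  ContMDiffAt.congr_of_eventuallyEq h (hs.mono fun x hx => by simp only [hx])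

theorem HolAt.eventually [IsManifold 𝓘(ℂ) ω X] {s : ∀ x, A.Fib x} {x₀ : X} (h : A.HolAt s x₀) :
    ∀ᶠ x in 𝓝 x₀, A.HolAt s x := by
  have := Bundle.TotalSpace.isManifold (n := ω) (IB := 𝓘(ℂ)) A.F A.Fib
  exact (contMDiffAt_iff_contMDiffAt_nhds (by simp)).1 h

theorem HolAt.add {s t : ∀ x, A.Fib x} {x₀ : X} (hs : A.HolAt s x₀) (ht : A.HolAt t x₀) :
    A.HolAt (fun x => s x + t x) x₀ :=
  ContMDiffAt.add_section hs ht

theorem HolAt.neg {s : ∀ x, A.Fib x} {x₀ : X} (hs : A.HolAt s x₀) :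
    A.HolAt (fun x => -s x) x₀ :=
  ContMDiffAt.neg_section hs

theorem HolAt.const_smul {s : ∀ x, A.Fib x} {x₀ : X} (c : ℂ) (hs : A.HolAt s x₀) :
    A.HolAt (fun x => c • s x) x₀ :=
  ContMDiffAt.const_smul_section hs

theorem holAt_sum_smul {ι : Type*} [Fintype ι] {f : ι → X → ℂ} {e : ι → ∀ x, A.Fib x} {x₀ : X}
    (hf : ∀ i, ContMDiffAt 𝓘(ℂ) 𝓘(ℂ) ω (f i) x₀) (he : ∀ i, A.HolAt (e i) x₀) :
    A.HolAt (fun x => ∑ i, f i x • e i x) x₀ :=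
  ContMDiffAt.sum_section fun i _ => (hf i).smul_section (he i)

end HolBundle

theorem contMDiffAt_clm_of_apply {E F : Type*} [NormedAddCommGroup E] [NormedSpace ℂ E]
    [FiniteDimensional ℂ E] [NormedAddCommGroup F] [NormedSpace ℂ F] {T : X → E →L[ℂ] F} {x₀ : X}
    (h : ∀ c, ContMDiffAt 𝓘(ℂ) 𝓘(ℂ, F) ω (fun x => T x c) x₀) :
    ContMDiffAt 𝓘(ℂ) 𝓘(ℂ, E →L[ℂ] F) ω T x₀ := by
  let b := finBasis ℂ E
  -- A linear map depends linearly on its values on a basis.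
  let L : (Fin (finrank ℂ E) → F) →L[ℂ] (E →L[ℂ] F) :=
    ∑ i, (ContinuousLinearMap.smulRightL ℂ E F (LinearMap.toContinuousLinearMap (b.coord i))).comp
      (ContinuousLinearMap.proj i)
  have hT : T = fun x => L fun i => T x (b i) := by
    funext x
    refine ContinuousLinearMap.coe_injective (b.ext fun j => ?_)
    simp [L, Finsupp.single_apply]
  rw [hT]
  have h2 : ContMDiffAt 𝓘(ℂ) 𝓘(ℂ, Fin (finrank ℂ E) → F) ω (fun x i => T x (b i)) x₀ :=
    contMDiffAt_pi_space.2 fun i => h (b i)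
  exact L.contMDiff.contMDiffAt.comp x₀ h2

/-- A solution `f` of a linear system `T f = g` with holomorphic data is holomorphic near each
point at which `T` is injective. -/
theorem contMDiffAt_of_injective_apply {E F : Type*} [NormedAddCommGroup E] [NormedSpace ℂ E]
    [FiniteDimensional ℂ E] [NormedAddCommGroup F] [NormedSpace ℂ F] [FiniteDimensional ℂ F]
    {T : X → E →L[ℂ] F} {f : X → E} {g : X → F} {x₀ : X}
    (hT : ContMDiffAt 𝓘(ℂ) 𝓘(ℂ, E →L[ℂ] F) ω T x₀) (hinj : Function.Injective (T x₀))
    (hg : ContMDiffAt 𝓘(ℂ) 𝓘(ℂ, F) ω g x₀) (h : ∀ᶠ x in 𝓝 x₀, T x (f x) = g x) :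
    ContMDiffAt 𝓘(ℂ) 𝓘(ℂ, E) ω f x₀ := by
  have : CompleteSpace E := FiniteDimensional.complete ℂ E
  obtain ⟨l, hl⟩ := (T x₀ : E →ₗ[ℂ] F).exists_leftInverse_of_injective
    (LinearMap.ker_eq_bot.2 hinj)
  -- With a left inverse `L` of `T x₀`, the maps `L ∘ T x` are invertible for `x` near `x₀`.
  let L : F →L[ℂ] E := LinearMap.toContinuousLinearMap l
  let S : X → E →L[ℂ] E := fun x => L.comp (T x)
  have hS : ContMDiffAt 𝓘(ℂ) 𝓘(ℂ, E →L[ℂ] E) ω S x₀ :=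
    contMDiffAt_const.clm_comp hT
  have hS0 : S x₀ = (ContinuousLinearEquiv.refl ℂ E : E →L[ℂ] E) := by
    ext v
    exact LinearMap.congr_fun hl v
  have hinv : ContMDiffAt 𝓘(ℂ) 𝓘(ℂ, E →L[ℂ] E) ω (fun x => (S x).inverse) x₀ := by
    have h1 := (contDiffAt_map_inverse (n := ω) (ContinuousLinearEquiv.refl ℂ E)).contMDiffAt
    rw [← hS0] at h1
    exact h1.comp x₀ hS
  have hev : ∀ᶠ x in 𝓝 x₀, S x ∈ Set.range
      (ContinuousLinearEquiv.toContinuousLinearMap : (E ≃L[ℂ] E) → (E →L[ℂ] E)) := by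
    refine hS.continuousAt ?_
    rw [hS0]
    exact ContinuousLinearEquiv.nhds _
  refine (hinv.clm_apply (contMDiffAt_const (c := L) |>.clm_apply hg)).congr_of_eventuallyEq ?_
  filter_upwards [hev, h] with x ⟨e, he⟩ hx
  rw [← hx, show L (T x (f x)) = S x (f x) from rfl, ← he, ContinuousLinearMap.inverse_equiv]
  simp

namespace HolBundle

variable {A : HolBundle.{u, v} X}

/-- The coefficients of a holomorphic section with respect to linearly independent holomorphic
sections are holomorphic. -/
theorem contMDiffAt_coeff {ι : Type*} [Fintype ι] {f : ι → X → ℂ} {e : ι → ∀ x, A.Fib x} {x₀ : X}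
    {s : ∀ x, A.Fib x} (he : ∀ i, A.HolAt (e i) x₀) (hli : LinearIndependent ℂ fun i => e i x₀)
    (hs : A.HolAt s x₀) (h : ∀ᶠ x in 𝓝 x₀, s x = ∑ i, f i x • e i x) (i : ι) :
    ContMDiffAt 𝓘(ℂ) 𝓘(ℂ) ω (f i) x₀ := by
  let T : X → (ι → ℂ) →L[ℂ] A.F := fun x => LinearMap.toContinuousLinearMap
    (Fintype.linearCombination ℂ fun i => A.read x₀ x (e i x))
  have hT : ContMDiffAt 𝓘(ℂ) 𝓘(ℂ, (ι → ℂ) →L[ℂ] A.F) ω T x₀ := by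
    refine contMDiffAt_clm_of_apply fun c => ?_
    have := holAt_iff_read.1 (holAt_sum_smul (f := fun i _ => c i)
      (fun i => contMDiffAt_const) he)
    simpa [T, Fintype.linearCombination_apply] using this
  have hinj : Function.Injective (T x₀) := by
    have h1 : LinearIndependent ℂ fun i => A.read x₀ x₀ (e i x₀) :=
      hli.map' (A.read x₀ x₀ : A.Fib x₀ →ₗ[ℂ] A.F) (LinearMap.ker_eq_bot.2 (read_injective x₀))
    exact h1.fintypeLinearCombination_injective
  have := contMDiffAt_of_injective_apply (f := fun x i => f i x) hT hinj (holAt_iff_read.1 hs) (by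
    filter_upwards [h] with x hx
    simp [T, Fintype.linearCombination_apply, hx])
  exact contMDiffAt_pi_space.1 this i

theorem eventually_linearIndependent {ι : Type*} [Finite ι] {e : ι → ∀ x, A.Fib x} {x₀ : X}
    (he : ∀ i, A.HolAt (e i) x₀) (hli : LinearIndependent ℂ fun i => e i x₀) :
    ∀ᶠ x in 𝓝 x₀, LinearIndependent ℂ fun i => e i x := by
  have := Fintype.ofFinite ι
  have h1 : LinearIndependent ℂ fun i => A.read x₀ x₀ (e i x₀) :=
    hli.map' (A.read x₀ x₀ : A.Fib x₀ →ₗ[ℂ] A.F) (LinearMap.ker_eq_bot.2 (read_injective x₀))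
  have hc : ContinuousAt (fun x i => A.read x₀ x (e i x)) x₀ :=
    continuousAt_pi.2 fun i => (holAt_iff_read.1 (he i)).continuousAt
  filter_upwards [hc.eventually h1.eventually] with x hx
  exact LinearIndependent.of_comp (A.read x₀ x : A.Fib x →ₗ[ℂ] A.F) hx

end HolBundle

/-- Around each point a subbundle has a holomorphic frame. -/
theorem HolSubbundle.exists_frame {A : HolBundle.{u, v} X} (S : HolSubbundle A) (x₀ : X) :
    ∃ e : Fin S.rank → ∀ x, A.Fib x, (∀ i, A.HolAt (e i) x₀) ∧
      ∀ᶠ x in 𝓝 x₀, LinearIndependent ℂ (fun i => e i x) ∧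
        Submodule.span ℂ (Set.range fun i => e i x) = S.fib x := by
  obtain ⟨U, hU, hx, e, he, h⟩ := S.locallyFree x₀
  exact ⟨e, fun i => (HolBundle.isHolOn_iff_holAt hU).1 (he i) x₀ hx,
    Filter.eventually_of_mem (hU.mem_nhds hx) h⟩

theorem HolSubbundle.finrank_fib {A : HolBundle.{u, v} X} (S : HolSubbundle A) (x : X) :
    finrank ℂ (S.fib x) = S.rank := by
  obtain ⟨e, -, h⟩ := S.exists_frame x
  obtain ⟨h1, h2⟩ := h.self_of_nhds
  rw [← h2, finrank_span_eq_card h1, Fintype.card_fin]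

theorem exists_eq_sum_of_mem_span {M ι : Type*} [AddCommGroup M] [Module ℂ M] [Fintype ι]
    {e : ι → M} {v : M} (h : v ∈ Submodule.span ℂ (Set.range e)) :
    ∃ c : ι → ℂ, v = ∑ i, c i • e i := by
  obtain ⟨c, hc⟩ := (Submodule.mem_span_range_iff_exists_fun ℂ).1 h
  exact ⟨c, hc.symm⟩

namespace HolBundle

variable {A : HolBundle.{u, v} X}

/-- Each vector of a fibre is the value of a section that is holomorphic near its base point. -/
theorem exists_holAt_eq (x₀ : X) (v : A.Fib x₀) : ∃ s : ∀ x, A.Fib x, A.HolAt s x₀ ∧ s x₀ = v := by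
  obtain ⟨e, he, h⟩ := (HolSubbundle.whole A).exists_frame x₀
  obtain ⟨-, h2⟩ := h.self_of_nhds
  have hv : v ∈ Submodule.span ℂ (Set.range fun i => e i x₀) := by
    rw [h2]
    exact Submodule.mem_top
  obtain ⟨c, rfl⟩ := exists_eq_sum_of_mem_span hv
  exact ⟨fun x => ∑ i, c i • e i x,
    holAt_sum_smul (f := fun i _ => c i) (fun i => contMDiffAt_const) he, rfl⟩

end HolBundle

end Sections

/-! ### Holomorphic families of linear maps -/

section Families

variable {X : Type u} [TopologicalSpace X] [ChartedSpace ℂ X]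

/-- The family `E` of linear maps between the fibres takes holomorphic sections to holomorphic
sections. -/
def IsHolFamily {A : HolBundle.{u, v} X} {B : HolBundle.{u, w} X}
    (E : ∀ x, A.Fib x →ₗ[ℂ] B.Fib x) : Prop :=
  ∀ (x₀ : X) (s : ∀ x, A.Fib x), A.HolAt s x₀ → B.HolAt (fun x => E x (s x)) x₀

/-- The holomorphic homomorphism with a given underlying family of linear maps. -/
def IsHolFamily.toHolHom {A : HolBundle.{u, v} X} {B : HolBundle.{u, w} X}
    {E : ∀ x, A.Fib x →ₗ[ℂ] B.Fib x} (h : IsHolFamily E) : HolHom A B where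
  toFun := E
  hol _ s hU hs := (HolBundle.isHolOn_iff_holAt hU).2 fun x hx =>
    h x s ((HolBundle.isHolOn_iff_holAt hU).1 hs x hx)

theorem HolBundle.HolAt.exists_isHolOn [IsManifold 𝓘(ℂ) ω X] {A : HolBundle.{u, v} X}
    {s : ∀ x, A.Fib x} {x₀ : X} (h : A.HolAt s x₀) :
    ∃ U, IsOpen U ∧ x₀ ∈ U ∧ A.IsHolOn U s := by
  obtain ⟨U, h1, h2, h3⟩ := eventually_nhds_iff.1 h.eventually
  exact ⟨U, h2, h3, (HolBundle.isHolOn_iff_holAt h2).2 h1⟩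

theorem SymplecticForm.contMDiffAt [IsManifold 𝓘(ℂ) ω X] {A : HolBundle.{u, v} X}
    (Ω : SymplecticForm A) {x₀ : X} {s t : ∀ x, A.Fib x} (hs : A.HolAt s x₀) (ht : A.HolAt t x₀) :
    ContMDiffAt 𝓘(ℂ) 𝓘(ℂ) ω (fun x => Ω.form x (s x) (t x)) x₀ := by
  obtain ⟨U, hU, hx, h⟩ := hs.exists_isHolOn
  obtain ⟨U', hU', hx', h'⟩ := ht.exists_isHolOn
  exact (Ω.hol (U ∩ U') s t (hU.inter hU') (h.mono Set.inter_subset_left)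
    (h'.mono Set.inter_subset_right)).contMDiffAt ((hU.inter hU').mem_nhds ⟨hx, hx'⟩)

/-- A section whose pairings with all holomorphic sections are holomorphic is holomorphic. -/
theorem SymplecticForm.holAt_of_pairing [IsManifold 𝓘(ℂ) ω X] {A : HolBundle.{u, v} X}
    (Ω : SymplecticForm A) {x₀ : X} {t : ∀ x, A.Fib x}
    (h : ∀ s : ∀ x, A.Fib x, A.HolAt s x₀ →
      ContMDiffAt 𝓘(ℂ) 𝓘(ℂ) ω (fun x => Ω.form x (s x) (t x)) x₀) : A.HolAt t x₀ := by
  obtain ⟨e, he, hev⟩ := (HolSubbundle.whole A).exists_frame x₀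
  have hex : ∀ x, ∃ c : Fin (HolSubbundle.whole A).rank → ℂ,
      (LinearIndependent ℂ (fun i => e i x) ∧
        Submodule.span ℂ (Set.range fun i => e i x) = ⊤) → t x = ∑ i, c i • e i x := by
    intro x
    by_cases hx : Submodule.span ℂ (Set.range fun i => e i x) = ⊤
    · obtain ⟨c, hc⟩ := exists_eq_sum_of_mem_span (v := t x) (hx ▸ Submodule.mem_top)
      exact ⟨c, fun _ => hc⟩
    · exact ⟨0, fun h => absurd h.2 hx⟩
  choose c hc using hex
  -- The coefficients of `t` in a frame solve the linear system given by the Gram matrix.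
  let T : X → (Fin (HolSubbundle.whole A).rank → ℂ) →L[ℂ] (Fin (HolSubbundle.whole A).rank → ℂ) :=
    fun x => LinearMap.toContinuousLinearMap (LinearMap.pi fun i =>
      (Ω.form x (e i x)).comp (Fintype.linearCombination ℂ fun j => e j x))
  have hT : ContMDiffAt 𝓘(ℂ)
      𝓘(ℂ, (Fin (HolSubbundle.whole A).rank → ℂ) →L[ℂ] (Fin (HolSubbundle.whole A).rank → ℂ))
      ω T x₀ := by
    refine contMDiffAt_clm_of_apply fun c => contMDiffAt_pi_space.2 fun i => ?_
    exact Ω.contMDiffAt (he i) (HolBundle.holAt_sum_smul (f := fun i _ => c i)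
      (fun i => contMDiffAt_const) he)
  have hinj : Function.Injective (T x₀) := by
    refine (injective_iff_map_eq_zero _).2 fun c h0 => ?_
    obtain ⟨h1, h2⟩ := hev.self_of_nhds
    have h3 : ∑ j, c j • e j x₀ = 0 := by
      refine Ω.nondegenerate x₀ _ fun b => ?_
      obtain ⟨d, rfl⟩ := exists_eq_sum_of_mem_span (v := b) (e := fun i => e i x₀)
        (by rw [h2]; exact Submodule.mem_top)
      have h4 : ∀ i, Ω.form x₀ (∑ j, c j • e j x₀) (e i x₀) = 0 := fun i => by
        have : Ω.form x₀ (e i x₀) (∑ j, c j • e j x₀) = 0 := congrFun h0 i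
        rwa [← LinearMap.IsAlt.neg (Ω.alternating x₀), neg_eq_zero]
      simp only [map_sum (Ω.form x₀ _), map_smul, h4, smul_zero, Finset.sum_const_zero]
    exact funext fun i => Fintype.linearIndependent_iff.1 h1 c h3 i
  have hcx : ContMDiffAt 𝓘(ℂ) 𝓘(ℂ, Fin (HolSubbundle.whole A).rank → ℂ) ω c x₀ := by
    refine contMDiffAt_of_injective_apply (g := fun x i => Ω.form x (e i x) (t x)) hT hinj
      (contMDiffAt_pi_space.2 fun i => h _ (he i)) ?_
    filter_upwards [hev] with x hx
    funext i
    rw [hc x hx]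
    rfl
  refine (HolBundle.holAt_sum_smul (fun i => contMDiffAt_pi_space.1 hcx i) he).congr ?_
  filter_upwards [hev] with x hx using hc x hx

/-- The image of a holomorphic family of linear maps of constant rank. -/
def IsHolFamily.range [IsManifold 𝓘(ℂ) ω X] {A : HolBundle.{u, v} X} {B : HolBundle.{u, w} X}
    {E : ∀ x, A.Fib x →ₗ[ℂ] B.Fib x} (h : IsHolFamily E) (r : ℕ)
    (hr : ∀ x, finrank ℂ (LinearMap.range (E x)) = r) : HolSubbundle B where
  fib x := LinearMap.range (E x)
  rank := r
  locallyFree x₀ := by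
    -- Extend preimages of a basis of the image at `x₀` to local sections; the images of these
    -- remain independent near `x₀`, and span the images of `E` because the rank is constant.
    let b := finBasisOfFinrankEq ℂ _ (hr x₀)
    choose a ha using fun i => (b i).2
    choose s hs hsa using fun i => A.exists_holAt_eq x₀ (a i)
    have he : ∀ i, B.HolAt (fun x => E x (s i x)) x₀ := fun i => h x₀ _ (hs i)
    have hli : LinearIndependent ℂ fun i => E x₀ (s i x₀) := by
      have := b.linearIndependent.map' (LinearMap.range (E x₀)).subtype (Submodule.ker_subtype _)
      have h2 : (fun i => E x₀ (s i x₀)) = (LinearMap.range (E x₀)).subtype ∘ b := by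
        funext i
        rw [hsa, ha]
        rfl
      rwa [h2]
    have hev : ∀ᶠ x in 𝓝 x₀, (∀ i, B.HolAt (fun x => E x (s i x)) x) ∧
        LinearIndependent ℂ fun i => E x (s i x) :=
      (Filter.eventually_all.2 fun i => (he i).eventually).and
        (HolBundle.eventually_linearIndependent he hli)
    obtain ⟨U, hU, hUo, hx⟩ := eventually_nhds_iff.1 hev
    refine ⟨U, hUo, hx, fun i x => E x (s i x),
      fun i => (HolBundle.isHolOn_iff_holAt hUo).2 fun x hx => (hU x hx).1 i,
      fun x hx => ⟨(hU x hx).2, ?_⟩⟩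
    refine Submodule.eq_of_le_of_finrank_eq (Submodule.span_le.2 ?_) ?_
    · rintro _ ⟨i, rfl⟩
      exact ⟨_, rfl⟩
    · rw [finrank_span_eq_card (hU x hx).2, Fintype.card_fin, hr]

/-- The projection onto a subbundle along a complementary subbundle is holomorphic. -/
theorem HolSubbundle.IsComplement.isHolFamily_projection {A : HolBundle.{u, v} X}
    {S T : HolSubbundle A} (h : S.IsComplement T) :
    IsHolFamily fun x => (S.fib x).projection (T.fib x) (h x) := by
  intro x₀ s hs
  obtain ⟨e, he, hev⟩ := S.exists_frame x₀
  obtain ⟨e', he', hev'⟩ := T.exists_frame x₀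
  have hex : ∀ x, ∃ c : Fin S.rank ⊕ Fin T.rank → ℂ,
      (Submodule.span ℂ (Set.range fun i => e i x) = S.fib x ∧
        Submodule.span ℂ (Set.range fun i => e' i x) = T.fib x) →
      (s x = ∑ i, c i • Sum.elim e e' i x ∧
        (S.fib x).projection (T.fib x) (h x) (s x) = ∑ i, c (Sum.inl i) • e i x) := by
    intro x
    by_cases hx : Submodule.span ℂ (Set.range fun i => e i x) = S.fib x ∧
        Submodule.span ℂ (Set.range fun i => e' i x) = T.fib x
    · obtain ⟨a, ha, b, hb, hab⟩ := Submodule.mem_sup.1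
        ((h x).sup_eq_top.symm ▸ Submodule.mem_top : s x ∈ S.fib x ⊔ T.fib x)
      have hpr : (S.fib x).projection (T.fib x) (h x) (s x) = a := by
        rw [← hab, map_add, Submodule.projection_apply_of_mem_left _ ha,
          Submodule.projection_apply_of_mem_right _ hb, add_zero]
      obtain ⟨c, hc⟩ := exists_eq_sum_of_mem_span (hx.1.symm ▸ ha)
      obtain ⟨d, hd⟩ := exists_eq_sum_of_mem_span (hx.2.symm ▸ hb)
      refine ⟨Sum.elim c d, fun _ => ⟨?_, ?_⟩⟩
      · rw [← hab, hc, hd]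
        simp
      · rw [hpr, hc]
        simp
    · exact ⟨0, fun h => absurd h hx⟩
  choose c hc using hex
  have hf : ∀ i, ContMDiffAt 𝓘(ℂ) 𝓘(ℂ) ω (fun x => c x i) x₀ := by
    refine HolBundle.contMDiffAt_coeff (e := Sum.elim e e') (s := s) ?_ ?_ hs ?_
    · rintro (i | i)
      exacts [he i, he' i]
    · obtain ⟨h1, h2⟩ := hev.self_of_nhds
      obtain ⟨h1', h2'⟩ := hev'.self_of_nhds
      have : LinearIndependent ℂ (Sum.elim (fun i => e i x₀) fun i => e' i x₀) :=
        h1.sum_type h1' (by rw [h2, h2']; exact (h x₀).disjoint)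
      convert this using 1
      funext i
      cases i <;> rfl
    · filter_upwards [hev, hev'] with x h1 h2 using (hc x ⟨h1.2, h2.2⟩).1
  refine (HolBundle.holAt_sum_smul (fun i => hf (Sum.inl i)) he).congr ?_
  filter_upwards [hev, hev'] with x h1 h2 using (hc x ⟨h1.2, h2.2⟩).2

/-! ### Sections of direct sums and duals -/

theorem HolBundle.HolAt.fst [IsManifold 𝓘(ℂ) ω X] {A : HolBundle.{u, v} X} {B : HolBundle.{u, w} X}
    {s : ∀ x, (A.prod B).Fib x} {x₀ : X} (h : (A.prod B).HolAt s x₀) :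
    A.HolAt (fun x => (s x).1) x₀ := by
  have h1 := (Bundle.contMDiffAt_section (F := A.F × B.F) (E := fun x => A.Fib x × B.Fib x) x₀).1 h
  exact (Bundle.contMDiffAt_section x₀).2
    ((contDiff_fst (𝕜 := ℂ) (E := A.F) (F := B.F)).contMDiff.contMDiffAt.comp x₀ h1)

theorem HolBundle.HolAt.snd [IsManifold 𝓘(ℂ) ω X] {A : HolBundle.{u, v} X} {B : HolBundle.{u, w} X}
    {s : ∀ x, (A.prod B).Fib x} {x₀ : X} (h : (A.prod B).HolAt s x₀) :
    B.HolAt (fun x => (s x).2) x₀ := by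
  have h1 := (Bundle.contMDiffAt_section (F := A.F × B.F) (E := fun x => A.Fib x × B.Fib x) x₀).1 h
  exact (Bundle.contMDiffAt_section x₀).2
    ((contDiff_snd (𝕜 := ℂ) (E := A.F) (F := B.F)).contMDiff.contMDiffAt.comp x₀ h1)

theorem HolBundle.HolAt.eval [IsManifold 𝓘(ℂ) ω X] {A : HolBundle.{u, v} X}
    {ξ : ∀ x, A.dual.Fib x} {s : ∀ x, A.Fib x} {x₀ : X} (hξ : A.dual.HolAt ξ x₀)
    (hs : A.HolAt s x₀) :
    ContMDiffAt 𝓘(ℂ) 𝓘(ℂ) ω (fun x => eval (ξ x) (s x)) x₀ := by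
  have h1 := ContMDiffAt.clm_bundle_apply (E₁ := A.Fib) (E₂ := Bundle.Trivial X ℂ) (F₁ := A.F)
    (F₂ := ℂ) (b := fun x : X => x) (ϕ := ξ) (v := s) hξ hs
  exact (Bundle.contMDiffAt_section x₀).1 h1

end Families

/-! ### A subbundle as a bundle in its own right -/

namespace HolSubbundle

variable {X : Type u} [TopologicalSpace X] [ChartedSpace ℂ X]
  {A : HolBundle.{u, v} X} (S : HolSubbundle A)

/-- The domain of a chosen frame of `S` around `x₀`. -/
def frameDomain (x₀ : X) : Set X := (S.locallyFree x₀).choose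

theorem isOpen_frameDomain (x₀ : X) : IsOpen (S.frameDomain x₀) :=
  (S.locallyFree x₀).choose_spec.1

theorem mem_frameDomain (x₀ : X) : x₀ ∈ S.frameDomain x₀ :=
  (S.locallyFree x₀).choose_spec.2.1

/-- A chosen frame of `S` around `x₀`. -/
def frame (x₀ : X) : Fin S.rank → ∀ x, A.Fib x := (S.locallyFree x₀).choose_spec.2.2.choose

theorem isFrameOn_frame (x₀ : X) : IsFrameOn A S.fib (S.frameDomain x₀) (S.frame x₀) :=
  (S.locallyFree x₀).choose_spec.2.2.choose_spec

theorem holAt_frame {x₀ x : X} (hx : x ∈ S.frameDomain x₀) (i : Fin S.rank) :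
    A.HolAt (S.frame x₀ i) x :=
  (HolBundle.isHolOn_iff_holAt (S.isOpen_frameDomain x₀)).1 ((S.isFrameOn_frame x₀).1 i) x hx

/-- The linear combinations of the chosen frame around `x₀`, at the point `x`. -/
def combine (x₀ x : X) : (Fin S.rank → ℂ) →ₗ[ℂ] A.Fib x :=
  Fintype.linearCombination ℂ fun i => S.frame x₀ i x

theorem combine_apply (x₀ x : X) (c : Fin S.rank → ℂ) :
    S.combine x₀ x c = ∑ i, c i • S.frame x₀ i x :=
  Fintype.linearCombination_apply ..

theorem combine_injective {x₀ x : X} (hx : x ∈ S.frameDomain x₀) :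
    Function.Injective (S.combine x₀ x) :=
  ((S.isFrameOn_frame x₀).2 x hx).1.fintypeLinearCombination_injective

theorem range_combine {x₀ x : X} (hx : x ∈ S.frameDomain x₀) :
    LinearMap.range (S.combine x₀ x) = S.fib x := by
  rw [combine, Fintype.range_linearCombination]
  exact ((S.isFrameOn_frame x₀).2 x hx).2

theorem combine_mem {x₀ x : X} (hx : x ∈ S.frameDomain x₀) (c : Fin S.rank → ℂ) :
    S.combine x₀ x c ∈ S.fib x :=
  S.range_combine hx ▸ LinearMap.mem_range_self _ c

theorem exists_coords (x₀ x : X) : ∃ l : A.Fib x →ₗ[ℂ] (Fin S.rank → ℂ),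
    x ∈ S.frameDomain x₀ → l ∘ₗ S.combine x₀ x = LinearMap.id := by
  by_cases hx : x ∈ S.frameDomain x₀
  · obtain ⟨l, hl⟩ := (S.combine x₀ x).exists_leftInverse_of_injective
      (LinearMap.ker_eq_bot.2 (S.combine_injective hx))
    exact ⟨l, fun _ => hl⟩
  · exact ⟨0, fun h => absurd h hx⟩

/-- The coordinates of the vectors of `S` with respect to the chosen frame around `x₀`, extended
arbitrarily to the fibre of `A`. -/
def coords (x₀ x : X) : A.Fib x →ₗ[ℂ] (Fin S.rank → ℂ) := (S.exists_coords x₀ x).choose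

theorem coords_combine {x₀ x : X} (hx : x ∈ S.frameDomain x₀) (c : Fin S.rank → ℂ) :
    S.coords x₀ x (S.combine x₀ x c) = c :=
  LinearMap.congr_fun ((S.exists_coords x₀ x).choose_spec hx) c

theorem combine_coords {x₀ x : X} (hx : x ∈ S.frameDomain x₀) {v : A.Fib x} (hv : v ∈ S.fib x) :
    S.combine x₀ x (S.coords x₀ x v) = v := by
  rw [← S.range_combine hx] at hv
  obtain ⟨c, rfl⟩ := hv
  rw [S.coords_combine hx]

/-- A section of `S` is holomorphic if and only if its coordinates are. -/
theorem holAt_combine_iff {x₀ y : X} (hy : y ∈ S.frameDomain x₀) {c : X → Fin S.rank → ℂ} :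
    A.HolAt (fun x => S.combine x₀ x (c x)) y ↔
      ContMDiffAt 𝓘(ℂ) 𝓘(ℂ, Fin S.rank → ℂ) ω c y := by
  simp only [combine_apply]
  refine ⟨fun h => contMDiffAt_pi_space.2 (HolBundle.contMDiffAt_coeff (S.holAt_frame hy)
      ((S.isFrameOn_frame x₀).2 y hy).1 h (Filter.Eventually.of_forall fun _ => rfl)),
    fun h => HolBundle.holAt_sum_smul (contMDiffAt_pi_space.1 h) (S.holAt_frame hy)⟩

/-- The transition functions between the chosen frames of `S`. -/
def coordChange (i j x : X) : (Fin S.rank → ℂ) →L[ℂ] (Fin S.rank → ℂ) :=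
  LinearMap.toContinuousLinearMap (S.coords j x ∘ₗ S.combine i x)

theorem coordChange_apply (i j x : X) (c : Fin S.rank → ℂ) :
    S.coordChange i j x c = S.coords j x (S.combine i x c) := rfl

theorem combine_coordChange {i j x : X} (hi : x ∈ S.frameDomain i) (hj : x ∈ S.frameDomain j)
    (c : Fin S.rank → ℂ) : S.combine j x (S.coordChange i j x c) = S.combine i x c :=
  S.combine_coords hj (S.combine_mem hi c)

theorem contMDiffOn_coordChange (i j : X) :
    ContMDiffOn 𝓘(ℂ) 𝓘(ℂ, (Fin S.rank → ℂ) →L[ℂ] (Fin S.rank → ℂ)) ω (S.coordChange i j)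
      (S.frameDomain i ∩ S.frameDomain j) := by
  rintro y ⟨hi, hj⟩
  refine (contMDiffAt_clm_of_apply fun c => (S.holAt_combine_iff hj).1 ?_).contMDiffWithinAt
  refine ((S.holAt_combine_iff hi).2 (contMDiffAt_const (c := c))).congr ?_
  filter_upwards [(S.isOpen_frameDomain i).mem_nhds hi, (S.isOpen_frameDomain j).mem_nhds hj]
    with x h1 h2 using S.combine_coordChange h1 h2 c

/-- The transition functions of `S`, as a cocycle indexed by the points of `X`. -/
def core : VectorBundleCore ℂ X (Fin S.rank → ℂ) X where
  baseSet := S.frameDomain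
  isOpen_baseSet := S.isOpen_frameDomain
  indexAt := id
  mem_baseSet_at := S.mem_frameDomain
  coordChange := S.coordChange
  coordChange_self i x hx c := S.coords_combine hx c
  continuousOn_coordChange i j := (S.contMDiffOn_coordChange i j).continuousOn
  coordChange_comp i j k x hx c := by
    rw [coordChange_apply, S.combine_coordChange hx.1.1 hx.1.2, coordChange_apply]

instance : S.core.IsContMDiff 𝓘(ℂ) ω := ⟨S.contMDiffOn_coordChange⟩

/-- The subbundle `S` as a holomorphic vector bundle.  Its fibres are spaces of coordinates, so that
it lives in the lowest universe. -/
def toBundle : HolBundle.{u, 0} X where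
  F := Fin S.rank → ℂ
  Fib := S.core.Fiber

@[simp] theorem rank_toBundle : S.toBundle.rank = S.rank := by
  change finrank ℂ (Fin S.rank → ℂ) = _
  simp

/-- The inclusion of the fibres of `S.toBundle` into those of `A`. -/
def incl (x : X) : S.toBundle.Fib x →ₗ[ℂ] A.Fib x := S.combine x x

/-- A retraction of `incl` on each fibre; it does not depend holomorphically on the point. -/
def retr (x : X) : A.Fib x →ₗ[ℂ] S.toBundle.Fib x := S.coords x x

theorem incl_injective (x : X) : Function.Injective (S.incl x) :=
  S.combine_injective (S.mem_frameDomain x)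

theorem range_incl (x : X) : LinearMap.range (S.incl x) = S.fib x :=
  S.range_combine (S.mem_frameDomain x)

theorem incl_mem {x : X} (c : S.toBundle.Fib x) : S.incl x c ∈ S.fib x :=
  S.combine_mem (S.mem_frameDomain x) c

@[simp] theorem retr_incl {x : X} (c : S.toBundle.Fib x) : S.retr x (S.incl x c) = c :=
  S.coords_combine (S.mem_frameDomain x) c

theorem incl_retr {x : X} {v : A.Fib x} (hv : v ∈ S.fib x) : S.incl x (S.retr x v) = v :=
  S.combine_coords (S.mem_frameDomain x) hv

theorem holAt_toBundle_iff {s : ∀ x, S.toBundle.Fib x} {x₀ : X} :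
    S.toBundle.HolAt s x₀ ↔ A.HolAt (fun x => S.incl x (s x)) x₀ := by
  have h1 : S.toBundle.HolAt s x₀ ↔ ContMDiffAt 𝓘(ℂ) 𝓘(ℂ, Fin S.rank → ℂ) ω
      (fun x => S.coordChange x x₀ x (s x)) x₀ :=
    Bundle.contMDiffAt_section (F := Fin S.rank → ℂ) (E := S.core.Fiber) x₀
  rw [h1, ← S.holAt_combine_iff (S.mem_frameDomain x₀)]
  have h2 : ∀ᶠ x in 𝓝 x₀, S.combine x₀ x (S.coordChange x x₀ x (s x)) = S.incl x (s x) := by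
    filter_upwards [(S.isOpen_frameDomain x₀).mem_nhds (S.mem_frameDomain x₀)] with x hx
    exact S.combine_coordChange (S.mem_frameDomain x) hx (s x)
  exact ⟨fun h => h.congr (h2.mono fun _ => Eq.symm), fun h => h.congr h2⟩

theorem isHolOn_toBundle_iff {s : ∀ x, S.toBundle.Fib x} {U : Set X} (hU : IsOpen U) :
    S.toBundle.IsHolOn U s ↔ A.IsHolOn U fun x => S.incl x (s x) := by
  simp only [HolBundle.isHolOn_iff_holAt hU, holAt_toBundle_iff]

theorem isHolFamily_incl : IsHolFamily S.incl := fun _ _ h => S.holAt_toBundle_iff.1 h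

/-! ### Subbundles of a subbundle, and their degrees -/

theorem isFrameOn_incl_iff {r : ℕ} {T : ∀ x, Submodule ℂ (S.toBundle.Fib x)} {U : Set X}
    (hU : IsOpen U) {e : Fin r → ∀ x, S.toBundle.Fib x} :
    IsFrameOn A (fun x => (T x).map (S.incl x)) U (fun i x => S.incl x (e i x)) ↔
      IsFrameOn S.toBundle T U e := by
  refine and_congr (forall_congr' fun i => (S.isHolOn_toBundle_iff hU).symm)
    (forall₂_congr fun x _ => and_congr ?_ ?_)
  · exact LinearMap.linearIndependent_iff (S.incl x) (LinearMap.ker_eq_bot.2 (S.incl_injective x))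
  · have : Set.range (fun i => S.incl x (e i x)) = S.incl x '' Set.range fun i => e i x := by
      rw [← Set.range_comp]
      rfl
    rw [this, ← Submodule.map_span]
    exact (Submodule.map_injective_of_injective (S.incl_injective x)).eq_iff

/-- A subbundle of `S`, as a subbundle of `A`. -/
def push (T : HolSubbundle S.toBundle) : HolSubbundle A where
  fib x := (T.fib x).map (S.incl x)
  rank := T.rank
  locallyFree x₀ := by
    obtain ⟨U, hU, hx, e, he⟩ := T.locallyFree x₀
    exact ⟨U, hU, hx, _, (S.isFrameOn_incl_iff hU).2 he⟩

theorem hasDegree_push_iff (T : HolSubbundle S.toBundle) (d : ℤ) :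
    (S.push T).HasDegree d ↔ T.HasDegree d := by
  constructor
  · rintro ⟨s, ord, h, hd⟩
    refine ⟨fun i x => S.retr x (s i x), ord, fun x₀ => ?_, hd⟩
    obtain ⟨U, hU, hx, e, a, he, hs, h1⟩ := h x₀
    -- `retr` is not holomorphic, but `e` takes its values in `S` on `U`, where `incl ∘ retr` is the
    -- identity; so `retr ∘ e` is a holomorphic frame there.
    have he' : IsFrameOn A (S.push T).fib U fun i x => S.incl x (S.retr x (e i x)) := by
      have hS : ∀ i, ∀ x ∈ U, S.incl x (S.retr x (e i x)) = e i x := fun i x hx => by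
        refine S.incl_retr ?_
        have h2 : e i x ∈ (S.push T).fib x := by
          rw [← (he.2 x hx).2]
          exact Submodule.subset_span ⟨i, rfl⟩
        obtain ⟨c, -, hc⟩ := h2
        exact hc ▸ S.incl_mem c
      refine ⟨fun i => (he.1 i).congr fun x hx => by simp only [hS i x hx], fun x hx => ?_⟩
      simp only [fun i => hS i x hx]
      exact he.2 x hx
    refine ⟨U, hU, hx, fun i x => S.retr x (e i x), a, (S.isFrameOn_incl_iff hU).1 he', ?_, h1⟩
    filter_upwards [hs] with x hx j
    simp only [hx j, map_sum, map_smul]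
    rfl
  · rintro ⟨s, ord, h, hd⟩
    refine ⟨fun i x => S.incl x (s i x), ord, fun x₀ => ?_, hd⟩
    obtain ⟨U, hU, hx, e, a, he, hs, h1⟩ := h x₀
    refine ⟨U, hU, hx, fun i x => S.incl x (e i x), a, (S.isFrameOn_incl_iff hU).2 he, ?_, h1⟩
    filter_upwards [hs] with x hx j
    simp only [hx j, map_sum, map_smul]
    rfl

open Classical in
/-- The degree of a subbundle of `S` does not change when it is viewed as a subbundle of `A`: it is
computed from the same frames. -/
@[simp] theorem degree_push (T : HolSubbundle S.toBundle) : (S.push T).degree = T.degree := by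
  have h : (S.push T).HasDegree = T.HasDegree := funext fun d => propext (S.hasDegree_push_iff T d)
  have key : ∀ P Q : ℤ → Prop, P = Q → (if h : ∃ d, P d then h.choose else 0) =
      if h : ∃ d, Q d then h.choose else 0 := by
    rintro P _ rfl
    rfl
  exact key _ _ h

theorem push_whole : S.push (whole S.toBundle) = S := by
  have key : ∀ T T' : HolSubbundle A, T.fib = T'.fib → T.rank = T'.rank → T = T' := by
    rintro ⟨f, r, _⟩ ⟨f', r', _⟩ hf hr
    cases hf
    cases hr
    rfl
  refine key _ _ (funext fun x => ?_) S.rank_toBundle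
  exact (Submodule.map_top _).trans (S.range_incl x)

theorem degree_toBundle : S.toBundle.degree = S.degree := by
  rw [HolBundle.degree, ← degree_push, push_whole]

end HolSubbundle

/-! ### Adjoints and isotropic projections on a symplectic bundle -/

section Symplectic

variable {X : Type u} [TopologicalSpace X] [ChartedSpace ℂ X]

/-- The ring of families of endomorphisms of the fibres of `A`, with no regularity in the point. -/
abbrev HolBundle.Endo (A : HolBundle.{u, v} X) : Type _ := ∀ x, Module.End ℂ (A.Fib x)

/-- The evaluation pairing, as a linear map from the dual bundle to the algebraic dual. -/
def HolBundle.evalHom (A : HolBundle.{u, v} X) (x : X) : A.dual.Fib x →ₗ[ℂ] Dual ℂ (A.Fib x) where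
  toFun ξ :=
    { toFun := eval ξ
      map_add' := fun a b => ContinuousLinearMap.map_add (M₂ := ℂ) ξ a b
      map_smul' := fun c a => ContinuousLinearMap.map_smul (M₂ := ℂ) ξ c a }
  map_add' _ _ := rfl
  map_smul' _ _ := rfl

@[simp] theorem HolBundle.evalHom_apply {A : HolBundle.{u, v} X} {x : X} (ξ : A.dual.Fib x)
    (a : A.Fib x) : A.evalHom x ξ a = eval ξ a := rfl

/-- A linear functional on a fibre, as a vector of the dual bundle. -/
def HolBundle.toDual {A : HolBundle.{u, v} X} {x : X} (φ : Dual ℂ (A.Fib x)) : A.dual.Fib x :=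
  (LinearMap.toContinuousLinearMap φ : A.Fib x →L[ℂ] ℂ)

@[simp] theorem HolBundle.eval_toDual {A : HolBundle.{u, v} X} {x : X} (φ : Dual ℂ (A.Fib x))
    (a : A.Fib x) : eval (HolBundle.toDual φ) a = φ a := rfl

theorem HolBundle.dual_ext {A : HolBundle.{u, v} X} {x : X} {ξ η : A.dual.Fib x}
    (h : ∀ a, eval ξ a = eval η a) : ξ = η :=
  ContinuousLinearMap.ext (M₂ := ℂ) h

theorem HolBundle.eq_zero_of_eval {A : HolBundle.{u, v} X} {x : X} {a : A.Fib x}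
    (h : ∀ ξ : A.dual.Fib x, eval ξ a = 0) : a = 0 :=
  (Module.forall_dual_apply_eq_zero_iff ℂ a).1 fun φ => h (HolBundle.toDual φ)

namespace SymplecticForm

variable {A : HolBundle.{u, v} X} (Ω : SymplecticForm A)

theorem form_swap (x : X) (a b : A.Fib x) : Ω.form x a b = -Ω.form x b a :=
  (LinearMap.IsAlt.neg (Ω.alternating x) b a).symm

theorem eq_of_form {x : X} {b c : A.Fib x} (h : ∀ a, Ω.form x a b = Ω.form x a c) : b = c := by
  refine sub_eq_zero.1 (Ω.nondegenerate x _ fun a => ?_)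
  rw [Ω.form_swap, map_sub, h, sub_self, neg_zero]

/-- The vector representing a linear functional through `Ω`. -/
def sharp (x : X) : Dual ℂ (A.Fib x) ≃ₗ[ℂ] A.Fib x :=
  (LinearMap.linearEquivOfInjective (Ω.form x).flip
    (fun _ _ h => Ω.eq_of_form fun a => LinearMap.congr_fun h a)
    Subspace.dual_finrank_eq.symm).symm

@[simp] theorem form_sharp (x : X) (a : A.Fib x) (φ : Dual ℂ (A.Fib x)) :
    Ω.form x a (Ω.sharp x φ) = φ a := by
  have h : (Ω.sharp x).symm (Ω.sharp x φ) = φ := (Ω.sharp x).symm_apply_apply φ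
  exact LinearMap.congr_fun h a

/-- The adjoint of a family of endomorphisms. -/
def adj (E : A.Endo) : A.Endo := fun x =>
  (Ω.sharp x : Dual ℂ (A.Fib x) →ₗ[ℂ] A.Fib x) ∘ₗ (E x).dualMap ∘ₗ (Ω.form x).flip

@[simp] theorem form_adj (E : A.Endo) (x : X) (a b : A.Fib x) :
    Ω.form x a (Ω.adj E x b) = Ω.form x (E x a) b :=
  Ω.form_sharp x a _

theorem form_adj_left (E : A.Endo) (x : X) (a b : A.Fib x) :
    Ω.form x (Ω.adj E x a) b = Ω.form x a (E x b) := by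
  rw [Ω.form_swap, form_adj, ← Ω.form_swap]

theorem eq_adj {E E' : A.Endo} (h : ∀ x a b, Ω.form x (E x a) b = Ω.form x a (E' x b)) :
    E' = Ω.adj E :=
  funext fun x => LinearMap.ext fun b => Ω.eq_of_form fun a => by rw [form_adj, h]

theorem adj_adj (E : A.Endo) : Ω.adj (Ω.adj E) = E :=
  (Ω.eq_adj fun x a b => Ω.form_adj_left E x a b).symm

theorem adj_mul (E E' : A.Endo) : Ω.adj (E * E') = Ω.adj E' * Ω.adj E :=
  (Ω.eq_adj fun x a b => by simp).symm

theorem adj_add (E E' : A.Endo) : Ω.adj (E + E') = Ω.adj E + Ω.adj E' :=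
  (Ω.eq_adj fun x a b => by simp).symm

theorem adj_sub (E E' : A.Endo) : Ω.adj (E - E') = Ω.adj E - Ω.adj E' :=
  (Ω.eq_adj fun x a b => by simp).symm

theorem adj_one : Ω.adj 1 = 1 :=
  (Ω.eq_adj fun x a b => by simp).symm

theorem isHolFamily_adj [IsManifold 𝓘(ℂ) ω X] {E : A.Endo} (hE : IsHolFamily E) :
    IsHolFamily (Ω.adj E) := by
  intro x₀ s hs
  refine Ω.holAt_of_pairing fun t ht => ?_
  simp only [form_adj]
  exact Ω.contMDiffAt (hE x₀ t ht) hs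

/-- The holomorphic family `P` is a projection of `A` onto the isotropic subbundle `S`. -/
structure IsIsotropicProj (S : HolSubbundle A) (P : A.Endo) : Prop where
  hol : IsHolFamily P
  mem : ∀ x v, P x v ∈ S.fib x
  apply_of_mem : ∀ x v, v ∈ S.fib x → P x v = v
  isotropic : S.IsIsotropic Ω

/-- The self-adjoint projection whose range is the sum of the ranges of the projection `P` and of
its adjoint, when the range of `P` is isotropic.  Its complement is `(1 - P) (1 - P†)`. -/
def doubleProj (P : A.Endo) : A.Endo := P + Ω.adj P - P * Ω.adj P

theorem adj_doubleProj (P : A.Endo) : Ω.adj (Ω.doubleProj P) = Ω.doubleProj P := by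
  rw [doubleProj, adj_sub, adj_add, adj_mul, adj_adj, add_comm P]

theorem doubleProj_mul_of_mul_eq {P R : A.Endo} (hR : Ω.adj R = R) (h : R * P = P)
    (h' : P * R = P) : Ω.doubleProj P * R = Ω.doubleProj P := by
  have h1 : Ω.adj P * R = Ω.adj P := by
    nth_rewrite 1 [← hR]
    rw [← adj_mul, h]
  rw [doubleProj, sub_mul, add_mul, mul_assoc, h1, h']

theorem mul_doubleProj_of_mul_eq {P R : A.Endo} (hR : Ω.adj R = R) (h : R * P = P)
    (h' : P * R = P) : R * Ω.doubleProj P = Ω.doubleProj P := by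
  have := congrArg Ω.adj (Ω.doubleProj_mul_of_mul_eq hR h h')
  rwa [adj_mul, adj_doubleProj, hR] at this

namespace IsIsotropicProj

variable {Ω} {S : HolSubbundle A} {P : A.Endo}

theorem mul_self (h : Ω.IsIsotropicProj S P) : P * P = P :=
  funext fun x => LinearMap.ext fun v => h.apply_of_mem x _ (h.mem x v)

theorem adj_mul_self (h : Ω.IsIsotropicProj S P) : Ω.adj P * P = 0 :=
  funext fun x => LinearMap.ext fun v => Ω.eq_of_form fun a => by
    simpa using h.isotropic x _ (h.mem x a) _ (h.mem x v)

theorem doubleProj_mul (h : Ω.IsIsotropicProj S P) : Ω.doubleProj P * P = P := by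
  rw [doubleProj, sub_mul, add_mul, mul_assoc, h.adj_mul_self, h.mul_self, mul_zero, add_zero,
    sub_zero]

theorem doubleProj_mul_adj (h : Ω.IsIsotropicProj S P) :
    Ω.doubleProj P * Ω.adj P = Ω.adj P := by
  have h1 : Ω.adj P * Ω.adj P = Ω.adj P := by rw [← adj_mul, h.mul_self]
  rw [doubleProj, sub_mul, add_mul, mul_assoc, h1, add_sub_cancel_left]

theorem doubleProj_mul_self (h : Ω.IsIsotropicProj S P) :
    Ω.doubleProj P * Ω.doubleProj P = Ω.doubleProj P := by
  nth_rewrite 2 [doubleProj]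
  rw [mul_sub, mul_add, ← mul_assoc, h.doubleProj_mul, h.doubleProj_mul_adj]
  rfl

end IsIsotropicProj

/-! ### The double of an isotropic subbundle -/

variable (S : HolSubbundle A) (P : A.Endo)

/-- The vector of `A` that represents `ξ ∘ P` through `Ω`, for a functional `ξ` on `S` and
a projection `P` onto `S`. -/
def preDualIncl (x : X) : S.toBundle.dual.Fib x →ₗ[ℂ] A.Fib x :=
  (Ω.sharp x : Dual ℂ (A.Fib x) →ₗ[ℂ] A.Fib x) ∘ₗ (S.retr x ∘ₗ P x).dualMap ∘ₗ
    S.toBundle.evalHom x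

theorem form_preDualIncl (x : X) (a : A.Fib x) (ξ : S.toBundle.dual.Fib x) :
    Ω.form x a (Ω.preDualIncl S P x ξ) = eval ξ (S.retr x (P x a)) :=
  Ω.form_sharp x a _

/-- The embedding of the dual of `S` in `A` onto an isotropic subbundle dual to `S`.  The graph
correction by `-P/2` makes the image isotropic. -/
def dualIncl (x : X) : S.toBundle.dual.Fib x →ₗ[ℂ] A.Fib x :=
  (1 - (2 : ℂ)⁻¹ • P x : Module.End ℂ (A.Fib x)) ∘ₗ Ω.preDualIncl S P x

theorem dualIncl_apply (x : X) (ξ : S.toBundle.dual.Fib x) :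
    Ω.dualIncl S P x ξ =
      Ω.preDualIncl S P x ξ - (2 : ℂ)⁻¹ • P x (Ω.preDualIncl S P x ξ) := rfl

/-- The map `S ⊕ S* → A` given by the inclusion of `S` and the embedding of its dual. -/
def doubleIncl (x : X) : (S.toBundle.prod S.toBundle.dual).Fib x →ₗ[ℂ] A.Fib x :=
  LinearMap.coprod (S.incl x) (Ω.dualIncl S P x)

theorem doubleIncl_apply (x : X) (c : (S.toBundle.prod S.toBundle.dual).Fib x) :
    Ω.doubleIncl S P x c = S.incl x c.1 + Ω.dualIncl S P x c.2 := rfl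

namespace IsIsotropicProj

variable {Ω} {S : HolSubbundle A} {P : A.Endo}

theorem form_incl_incl (h : Ω.IsIsotropicProj S P) (x : X) (c d : S.toBundle.Fib x) :
    Ω.form x (S.incl x c) (S.incl x d) = 0 :=
  h.isotropic x _ (S.incl_mem c) _ (S.incl_mem d)

theorem form_incl_dualIncl (h : Ω.IsIsotropicProj S P) (x : X) (c : S.toBundle.Fib x)
    (ξ : S.toBundle.dual.Fib x) : Ω.form x (S.incl x c) (Ω.dualIncl S P x ξ) = eval ξ c := by
  rw [dualIncl_apply, map_sub, map_smul, form_preDualIncl,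
    h.apply_of_mem x _ (S.incl_mem c), S.retr_incl,
    h.isotropic x _ (S.incl_mem c) _ (h.mem x _), smul_zero, sub_zero]

theorem form_dualIncl_dualIncl (h : Ω.IsIsotropicProj S P) (x : X)
    (ξ η : S.toBundle.dual.Fib x) :
    Ω.form x (Ω.dualIncl S P x ξ) (Ω.dualIncl S P x η) = 0 := by
  have key : ∀ ξ η : S.toBundle.dual.Fib x,
      Ω.form x (P x (Ω.preDualIncl S P x ξ)) (Ω.preDualIncl S P x η) =
        Ω.form x (Ω.preDualIncl S P x ξ) (Ω.preDualIncl S P x η) := fun ξ η => by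
    rw [form_preDualIncl, h.apply_of_mem x _ (h.mem x _), form_preDualIncl]
  have key2 : Ω.form x (Ω.preDualIncl S P x ξ) (P x (Ω.preDualIncl S P x η)) =
        Ω.form x (Ω.preDualIncl S P x ξ) (Ω.preDualIncl S P x η) := by
    rw [Ω.form_swap, key, ← Ω.form_swap]
  simp only [dualIncl_apply, map_sub, map_smul, LinearMap.sub_apply, LinearMap.smul_apply, key,
    key2, h.isotropic x _ (h.mem x _) _ (h.mem x _), smul_eq_mul]
  ring

theorem form_doubleIncl (h : Ω.IsIsotropicProj S P) (x : X)
    (c d : (S.toBundle.prod S.toBundle.dual).Fib x) :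
    Ω.form x (Ω.doubleIncl S P x c) (Ω.doubleIncl S P x d) = standardForm S.toBundle x c d := by
  rw [doubleIncl_apply, doubleIncl_apply, map_add, map_add, LinearMap.add_apply,
    LinearMap.add_apply, h.form_incl_incl, h.form_dualIncl_dualIncl, h.form_incl_dualIncl,
    Ω.form_swap x (Ω.dualIncl S P x c.2), h.form_incl_dualIncl, standardForm]
  ring

theorem doubleIncl_injective (h : Ω.IsIsotropicProj S P) (x : X) :
    Function.Injective (Ω.doubleIncl S P x) := by
  refine (injective_iff_map_eq_zero _).2 fun c hc => ?_
  have h0 : ∀ d, standardForm S.toBundle x c d = 0 := fun d => by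
    rw [← h.form_doubleIncl, hc, map_zero, LinearMap.zero_apply]
  have h1 : c.1 = 0 := HolBundle.eq_zero_of_eval fun ξ => by
    have := h0 (0, ξ)
    simpa [standardForm, ← HolBundle.evalHom_apply] using this
  have h2 : c.2 = 0 := HolBundle.dual_ext fun a => by
    have h3 := h0 (a, 0)
    simp only [standardForm, sub_eq_zero] at h3
    exact h3.symm
  exact Prod.ext h1 h2

theorem isHolFamily_doubleIncl [IsManifold 𝓘(ℂ) ω X] (h : Ω.IsIsotropicProj S P) :
    IsHolFamily (Ω.doubleIncl S P) := by
  intro x₀ s hs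
  have h1 : A.HolAt (fun x => Ω.preDualIncl S P x (s x).2) x₀ := by
    refine Ω.holAt_of_pairing fun t ht => ?_
    simp only [form_preDualIncl]
    refine HolBundle.HolAt.eval hs.snd (S.holAt_toBundle_iff.2 ((h.hol x₀ t ht).congr ?_))
    exact Filter.Eventually.of_forall fun x => S.incl_retr (h.mem x _)
  refine ((S.holAt_toBundle_iff.1 hs.fst).add
    (h1.add ((h.hol x₀ _ h1).const_smul (2 : ℂ)⁻¹).neg)).congr ?_
  refine Filter.Eventually.of_forall fun x => ?_
  rw [doubleIncl_apply, dualIncl_apply, sub_eq_add_neg]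

theorem range_doubleIncl (h : Ω.IsIsotropicProj S P) (x : X) :
    LinearMap.range (Ω.doubleIncl S P x) = LinearMap.range (Ω.doubleProj P x) := by
  have hP : ∀ v, P x v ∈ LinearMap.range (Ω.doubleIncl S P x) := fun v =>
    ⟨(S.retr x (P x v), 0), by
      change S.incl x (S.retr x (P x v)) + Ω.dualIncl S P x 0 = P x v
      rw [map_zero, add_zero, S.incl_retr (h.mem x v)]⟩
  have hadj : ∀ ξ, Ω.adj P x (Ω.preDualIncl S P x ξ) = Ω.preDualIncl S P x ξ := fun ξ =>
    Ω.eq_of_form fun a => by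
      rw [form_adj, form_preDualIncl, form_preDualIncl, h.apply_of_mem x _ (h.mem x a)]
  have hQ : ∀ v, Ω.doubleProj P x (P x v) = P x v := fun v =>
    LinearMap.congr_fun (congrFun h.doubleProj_mul x) v
  have hQadj : ∀ v, Ω.doubleProj P x (Ω.adj P x v) = Ω.adj P x v := fun v =>
    LinearMap.congr_fun (congrFun h.doubleProj_mul_adj x) v
  apply le_antisymm
  · rintro _ ⟨c, rfl⟩
    refine ⟨Ω.doubleIncl S P x c, ?_⟩
    rw [doubleIncl_apply, dualIncl_apply, map_add, map_sub, map_smul, hQ,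
      ← h.apply_of_mem x _ (S.incl_mem c.1), hQ, ← hadj, hQadj]
  · rintro _ ⟨v, rfl⟩
    -- Each of the three terms of the double projection takes its values in the image of `S ⊕ S*`.
    have h1 : Ω.doubleProj P x v = P x v + Ω.adj P x v - P x (Ω.adj P x v) := rfl
    have h2 : Ω.adj P x v ∈ LinearMap.range (Ω.doubleIncl S P x) := by
      let ξ : S.toBundle.dual.Fib x :=
        HolBundle.toDual ((Ω.form x).flip v ∘ₗ S.incl x)
      have h3 : Ω.adj P x v = Ω.preDualIncl S P x ξ := Ω.eq_of_form fun a => by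
        rw [form_adj, form_preDualIncl, HolBundle.eval_toDual, LinearMap.comp_apply,
          S.incl_retr (h.mem x a)]
        rfl
      have h4 : Ω.preDualIncl S P x ξ = Ω.doubleIncl S P x (0, ξ) +
          (2 : ℂ)⁻¹ • P x (Ω.preDualIncl S P x ξ) := by
        change _ = S.incl x 0 + Ω.dualIncl S P x ξ + _
        rw [map_zero, zero_add, dualIncl_apply, sub_add_cancel]
      rw [h3, h4]
      exact add_mem ⟨_, rfl⟩ (Submodule.smul_mem _ _ (hP _))
    rw [h1]
    exact sub_mem (add_mem (hP v) h2) (hP _)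

theorem finrank_range_doubleProj (h : Ω.IsIsotropicProj S P) (x : X) :
    finrank ℂ (LinearMap.range (Ω.doubleProj P x)) = 2 * S.rank := by
  have h1 : finrank ℂ (S.toBundle.Fib x) = S.rank := by
    rw [← S.finrank_fib x, ← S.range_incl x, LinearMap.finrank_range_of_inj (S.incl_injective x)]
  have h2 : finrank ℂ (S.toBundle.dual.Fib x) = S.rank := by
    refine Eq.trans ?_ (Subspace.dual_finrank_eq.trans h1)
    exact (LinearMap.toContinuousLinearMap (𝕜 := ℂ) (E := S.toBundle.Fib x)
      (F' := ℂ)).finrank_eq.symm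
  rw [← h.range_doubleIncl, LinearMap.finrank_range_of_inj (h.doubleIncl_injective x)]
  have h3 : finrank ℂ ((S.toBundle.prod S.toBundle.dual).Fib x) =
      finrank ℂ (S.toBundle.Fib x) + finrank ℂ (S.toBundle.dual.Fib x) :=
    Module.finrank_prod
  rw [h3, h1, h2, two_mul]

/-- Maps `b : A → B` and `g : B → A` that are skew-adjoint to each other and commute with the
projections onto isotropic subbundles act on the doubles of these by the restrictions of `b` and of
`-gᵗ`. -/
theorem map_doubleIncl {B : HolBundle.{u, v} X} {ΩB : SymplecticForm B} {T : HolSubbundle B}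
    {PB : B.Endo} (hB : ΩB.IsIsotropicProj T PB) {x : X}
    (b : A.Fib x →ₗ[ℂ] B.Fib x) (g : B.Fib x →ₗ[ℂ] A.Fib x)
    (hskew : ∀ a v, ΩB.form x (b a) v = -Ω.form x a (g v))
    (hb : ∀ a, b (P x a) = PB x (b a)) (hg : ∀ v, g (PB x v) = P x (g v))
    (hbS : ∀ a ∈ S.fib x, b a ∈ T.fib x) (c : (S.toBundle.prod S.toBundle.dual).Fib x) :
    b (Ω.doubleIncl S P x c) = ΩB.doubleIncl T PB x
      (T.retr x (b (S.incl x c.1)),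
        negTranspose (A := T.toBundle) (S.retr x ∘ₗ g ∘ₗ T.incl x) c.2) := by
  have h1 : b (Ω.preDualIncl S P x c.2) = ΩB.preDualIncl T PB x
      (negTranspose (A := T.toBundle) (S.retr x ∘ₗ g ∘ₗ T.incl x) c.2) := ΩB.eq_of_form fun v => by
    rw [ΩB.form_swap, hskew, neg_neg, Ω.form_swap, form_preDualIncl, form_preDualIncl,
      eval_negTranspose, LinearMap.comp_apply, LinearMap.comp_apply, T.incl_retr (hB.mem x v), hg]
  change _ = T.incl x (T.retr x (b (S.incl x c.1))) + ΩB.dualIncl T PB x _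
  rw [doubleIncl_apply, dualIncl_apply, dualIncl_apply, map_add, map_sub, map_smul, hb, h1,
    T.incl_retr (hbS _ (S.incl_mem c.1))]
  rfl

end IsIsotropicProj

end SymplecticForm

end Symplectic

section Restriction

variable {X : Type u} [TopologicalSpace X] [ChartedSpace ℂ X]

/-! ### Restriction of Higgs bundles to invariant subbundles -/

theorem HolBundle.finrank_fib (A : HolBundle.{u, v} X) (x : X) : finrank ℂ (A.Fib x) = A.rank :=
  (A.fibreEquiv x).toLinearEquiv.finrank_eq

theorem HolSubbundle.rank_le [Nonempty X] {A : HolBundle.{u, v} X} (S : HolSubbundle A) :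
    S.rank ≤ A.rank := by
  obtain ⟨x⟩ := ‹Nonempty X›
  rw [← S.finrank_fib x, ← A.finrank_fib x]
  exact Submodule.finrank_le _

theorem HolSubbundle.push_le {A : HolBundle.{u, v} X} {S : HolSubbundle A}
    (V' : HolSubbundle S.toBundle) (x : X) : (S.push V').fib x ≤ S.fib x := by
  rintro _ ⟨c, -, rfl⟩
  exact S.incl_mem c

/-- The restriction of a symplectic form to a subbundle on which it is nondegenerate. -/
def SymplecticForm.restrict {A : HolBundle.{u, v} X} (Ω : SymplecticForm A) (S : HolSubbundle A)
    (h : ∀ x, ∀ a ∈ S.fib x, (∀ b ∈ S.fib x, Ω.form x a b = 0) → a = 0) :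
    SymplecticForm S.toBundle where
  form x := (Ω.form x).compl₁₂ (S.incl x) (S.incl x)
  alternating x _ := Ω.alternating x _
  nondegenerate x a ha := S.incl_injective x <| by
    rw [map_zero]
    refine h x _ (S.incl_mem a) fun b hb => ?_
    rw [← S.incl_retr hb]
    exact ha _
  hol U s t hU hs ht := Ω.hol U _ _ hU ((S.isHolOn_toBundle_iff hU).1 hs)
    ((S.isHolOn_toBundle_iff hU).1 ht)

theorem HolSubbundle.IsIsotropic.push {A : HolBundle.{u, v} X} {Ω : SymplecticForm A}
    {S : HolSubbundle A} {h} {V' : HolSubbundle S.toBundle}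
    (h' : V'.IsIsotropic (Ω.restrict S h)) : (S.push V').IsIsotropic Ω := by
  rintro x _ ⟨c, hc, rfl⟩ _ ⟨d, hd, rfl⟩
  exact h' x c hc d hd

variable [IsManifold 𝓘(ℂ) ω X]

/-- The restriction of a twisted homomorphism to a subbundle, with values in a subbundle. -/
def TwistedHom.restrict {A : HolBundle.{u, v} X} {B : HolBundle.{u, w} X} (φ : TwistedHom A B)
    (S : HolSubbundle A) (T : HolSubbundle B)
    (h : ∀ x t, ∀ a ∈ S.fib x, φ.toFun x t a ∈ T.fib x) : TwistedHom S.toBundle T.toBundle where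
  toFun x := ((φ.toFun x).compl₂ (S.incl x)).compr₂ (T.retr x)
  hol U t s hU ht hs := (T.isHolOn_toBundle_iff hU).2 <|
    (φ.hol U t _ hU ht ((S.isHolOn_toBundle_iff hU).1 hs)).congr fun x _ => by
      change Bundle.TotalSpace.mk' B.F x (T.incl x (T.retr x (φ.toFun x (t x) _))) = _
      rw [T.incl_retr (h x _ _ (S.incl_mem _))]

theorem TwistedHom.incl_restrict {A : HolBundle.{u, v} X} {B : HolBundle.{u, w} X}
    (φ : TwistedHom A B) {S : HolSubbundle A} {T : HolSubbundle B}
    (h : ∀ x t, ∀ a ∈ S.fib x, φ.toFun x t a ∈ T.fib x) (x : X) (t : TangentSpace 𝓘(ℂ) x)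
    (c : S.toBundle.Fib x) :
    T.incl x ((φ.restrict S T h).toFun x t c) = φ.toFun x t (S.incl x c) :=
  T.incl_retr (h x t _ (S.incl_mem c))

/-- The restriction of a `U(p,q)`-Higgs bundle to an invariant pair of subbundles. -/
def UHiggs.restrict {p q : ℕ} (H : UHiggs.{u, v} X p q) (S : HolSubbundle H.V)
    (T : HolSubbundle H.W) (h : H.IsInvariant S T) {a b : ℕ} (ha : S.rank = a) (hb : T.rank = b) :
    UHiggs.{u, 0} X a b where
  V := S.toBundle
  W := T.toBundle
  rankV := S.rank_toBundle.trans ha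
  rankW := T.rank_toBundle.trans hb
  β := H.β.restrict T S fun x t => (h x t).1
  γ := H.γ.restrict S T fun x t => (h x t).2

theorem UHiggs.incl_restrict_β {p q : ℕ} (H : UHiggs.{u, v} X p q) {S : HolSubbundle H.V}
    {T : HolSubbundle H.W} (h : H.IsInvariant S T) {a b : ℕ} (ha : S.rank = a) (hb : T.rank = b)
    (x : X) (t : TangentSpace 𝓘(ℂ) x) (c : T.toBundle.Fib x) :
    S.incl x ((H.restrict S T h ha hb).β.toFun x t c) = H.β.toFun x t (T.incl x c) :=
  H.β.incl_restrict (fun x t => (h x t).1) x t c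

theorem UHiggs.incl_restrict_γ {p q : ℕ} (H : UHiggs.{u, v} X p q) {S : HolSubbundle H.V}
    {T : HolSubbundle H.W} (h : H.IsInvariant S T) {a b : ℕ} (ha : S.rank = a) (hb : T.rank = b)
    (x : X) (t : TangentSpace 𝓘(ℂ) x) (c : S.toBundle.Fib x) :
    T.incl x ((H.restrict S T h ha hb).γ.toFun x t c) = H.γ.toFun x t (S.incl x c) :=
  H.γ.incl_restrict (fun x t => (h x t).2) x t c

theorem UHiggs.IsInvariant.push {p q : ℕ} {H : UHiggs.{u, v} X p q} {S : HolSubbundle H.V}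
    {T : HolSubbundle H.W} {h : H.IsInvariant S T} {a b : ℕ} {ha : S.rank = a} {hb : T.rank = b}
    {V' : HolSubbundle S.toBundle} {W' : HolSubbundle T.toBundle}
    (h' : (H.restrict S T h ha hb).IsInvariant V' W') :
    H.IsInvariant (S.push V') (T.push W') := by
  refine fun x t => ⟨?_, ?_⟩
  · rintro _ ⟨c, hc, rfl⟩
    exact ⟨_, (h' x t).1 c hc, H.incl_restrict_β h ha hb x t c⟩
  · rintro _ ⟨c, hc, rfl⟩
    exact ⟨_, (h' x t).2 c hc, H.incl_restrict_γ h ha hb x t c⟩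

/-- An invariant pair of subbundles of ranks `2a` and `2b` on which the symplectic forms are
nondegenerate. -/
structure SymplecticPair {p q : ℕ} (H : SpHiggs.{u, v} X p q) (a b : ℕ) where
  V : HolSubbundle H.V
  W : HolSubbundle H.W
  invariant : H.IsInvariant V W
  nondegV : ∀ x, ∀ a ∈ V.fib x, (∀ b ∈ V.fib x, H.ΩV.form x a b = 0) → a = 0
  nondegW : ∀ x, ∀ a ∈ W.fib x, (∀ b ∈ W.fib x, H.ΩW.form x a b = 0) → a = 0
  rankV : V.rank = 2 * a
  rankW : W.rank = 2 * b

/-- The `Sp(2a,2b)`-Higgs bundle defined by a symplectic pair. -/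
def SymplecticPair.toSpHiggs {p q a b : ℕ} {H : SpHiggs.{u, v} X p q} (N : SymplecticPair H a b) :
    SpHiggs.{u, 0} X a b where
  toUHiggs := H.toUHiggs.restrict N.V N.W N.invariant N.rankV N.rankW
  ΩV := H.ΩV.restrict N.V N.nondegV
  ΩW := H.ΩW.restrict N.W N.nondegW
  skew x t w c := by
    have hβ := H.toUHiggs.incl_restrict_β N.invariant N.rankV N.rankW x t w
    have hγ := H.toUHiggs.incl_restrict_γ N.invariant N.rankV N.rankW x t c
    exact (congrArg (fun v => H.ΩV.form x v (N.V.incl x c)) hβ).trans <|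
      (H.skew x t (N.W.incl x w) (N.V.incl x c)).trans <|
      congrArg (fun v => -H.ΩW.form x (N.W.incl x w) v) hγ.symm

namespace SpHiggs

variable {p q : ℕ} (H : SpHiggs.{u, v} X p q)

theorem skew' (x : X) (t : TangentSpace 𝓘(ℂ) x) (a : H.V.Fib x) (w : H.W.Fib x) :
    H.ΩW.form x (H.γ.toFun x t a) w = -H.ΩV.form x a (H.β.toFun x t w) := by
  rw [H.ΩW.form_swap, ← H.skew, H.ΩV.form_swap]

/-- A pair of families of endomorphisms of the fibres of `V` and of `W`. -/
abbrev Endo : Type _ := H.V.Endo × H.W.Endo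

/-- A pair of holomorphic endomorphisms of `V` and `W` that commutes with the Higgs field. -/
structure IsHiggsEndo (E : H.Endo) : Prop where
  holV : IsHolFamily E.1
  holW : IsHolFamily E.2
  comm_β : ∀ x t w, H.β.toFun x t (E.2 x w) = E.1 x (H.β.toFun x t w)
  comm_γ : ∀ x t a, H.γ.toFun x t (E.1 x a) = E.2 x (H.γ.toFun x t a)

/-- The pair of adjoints with respect to the two symplectic forms. -/
def adj (E : H.Endo) : H.Endo := (H.ΩV.adj E.1, H.ΩW.adj E.2)

namespace IsHiggsEndo

variable {H} {E E' : H.Endo}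

theorem one : H.IsHiggsEndo 1 :=
  ⟨fun _ _ h => h, fun _ _ h => h, fun _ _ _ => rfl, fun _ _ _ => rfl⟩

theorem mul (h : H.IsHiggsEndo E) (h' : H.IsHiggsEndo E') : H.IsHiggsEndo (E * E') where
  holV x₀ s hs := h.holV x₀ _ (h'.holV x₀ s hs)
  holW x₀ s hs := h.holW x₀ _ (h'.holW x₀ s hs)
  comm_β x t w := (h.comm_β x t _).trans (congrArg (E.1 x) (h'.comm_β x t w))
  comm_γ x t w := (h.comm_γ x t _).trans (congrArg (E.2 x) (h'.comm_γ x t w))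

theorem add (h : H.IsHiggsEndo E) (h' : H.IsHiggsEndo E') : H.IsHiggsEndo (E + E') where
  holV x₀ s hs := (h.holV x₀ s hs).add (h'.holV x₀ s hs)
  holW x₀ s hs := (h.holW x₀ s hs).add (h'.holW x₀ s hs)
  comm_β x t w := by
    change H.β.toFun x t (E.2 x w + E'.2 x w) = E.1 x _ + E'.1 x _
    rw [map_add, h.comm_β, h'.comm_β]
  comm_γ x t w := by
    change H.γ.toFun x t (E.1 x w + E'.1 x w) = E.2 x _ + E'.2 x _
    rw [map_add, h.comm_γ, h'.comm_γ]

theorem neg (h : H.IsHiggsEndo E) : H.IsHiggsEndo (-E) where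
  holV x₀ s hs := (h.holV x₀ s hs).neg
  holW x₀ s hs := (h.holW x₀ s hs).neg
  comm_β x t w := by
    change H.β.toFun x t (-E.2 x w) = -E.1 x _
    rw [map_neg, h.comm_β]
  comm_γ x t w := by
    change H.γ.toFun x t (-E.1 x w) = -E.2 x _
    rw [map_neg, h.comm_γ]

theorem sub (h : H.IsHiggsEndo E) (h' : H.IsHiggsEndo E') : H.IsHiggsEndo (E - E') :=
  sub_eq_add_neg E E' ▸ h.add h'.neg

theorem adj (h : H.IsHiggsEndo E) : H.IsHiggsEndo (H.adj E) where
  holV := H.ΩV.isHolFamily_adj h.holV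
  holW := H.ΩW.isHolFamily_adj h.holW
  comm_β x t w := H.ΩV.eq_of_form fun a => by
    change H.ΩV.form x a (H.β.toFun x t (H.ΩW.adj E.2 x w)) =
      H.ΩV.form x a (H.ΩV.adj E.1 x (H.β.toFun x t w))
    rw [SymplecticForm.form_adj, ← neg_inj, ← H.skew', ← H.skew', SymplecticForm.form_adj, h.comm_γ]
  comm_γ x t a := H.ΩW.eq_of_form fun w => by
    change H.ΩW.form x w (H.γ.toFun x t (H.ΩV.adj E.1 x a)) =
      H.ΩW.form x w (H.ΩW.adj E.2 x (H.γ.toFun x t a))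
    rw [SymplecticForm.form_adj, ← neg_inj, ← H.skew, ← H.skew, SymplecticForm.form_adj, h.comm_β]

end IsHiggsEndo

/-- The projection of `H` onto an orthogonal direct summand. -/
structure IsSummandProj (R : H.Endo) : Prop extends H.IsHiggsEndo R where
  idem : IsIdempotentElem R
  adj_eq : H.adj R = R

namespace IsSummandProj

variable {H} {R : H.Endo}

theorem one : H.IsSummandProj 1 :=
  ⟨.one, .one, Prod.ext H.ΩV.adj_one H.ΩW.adj_one⟩

theorem sub {Q : H.Endo} (hR : H.IsSummandProj R) (hQ : H.IsSummandProj Q) (h : Q * R = Q)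
    (h' : R * Q = Q) : H.IsSummandProj (R - Q) where
  toIsHiggsEndo := hR.toIsHiggsEndo.sub hQ.toIsHiggsEndo
  idem := by
    rw [IsIdempotentElem, mul_sub, sub_mul, sub_mul, hR.idem.eq, hQ.idem.eq, h, h', sub_self,
      sub_zero]
  adj_eq := Prod.ext
    ((H.ΩV.adj_sub _ _).trans (congrArg Prod.fst (congrArg₂ (· - ·) hR.adj_eq hQ.adj_eq)))
    ((H.ΩW.adj_sub _ _).trans (congrArg Prod.snd (congrArg₂ (· - ·) hR.adj_eq hQ.adj_eq)))

theorem apply_fst (h : H.IsSummandProj R) {x : X} {v : H.V.Fib x}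
    (hv : v ∈ LinearMap.range (R.1 x)) : R.1 x v = v := by
  obtain ⟨w, rfl⟩ := hv
  exact LinearMap.congr_fun (congrFun (congrArg Prod.fst h.idem.eq) x) w

theorem apply_snd (h : H.IsSummandProj R) {x : X} {v : H.W.Fib x}
    (hv : v ∈ LinearMap.range (R.2 x)) : R.2 x v = v := by
  obtain ⟨w, rfl⟩ := hv
  exact LinearMap.congr_fun (congrFun (congrArg Prod.snd h.idem.eq) x) w

theorem form_fst (h : H.IsSummandProj R) {x : X} (v w : H.V.Fib x) :
    H.ΩV.form x (R.1 x v) w = H.ΩV.form x v (R.1 x w) := by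
  have h1 : H.ΩV.adj R.1 = R.1 := congrArg Prod.fst h.adj_eq
  rw [← H.ΩV.form_adj, h1]

theorem form_snd (h : H.IsSummandProj R) {x : X} (v w : H.W.Fib x) :
    H.ΩW.form x (R.2 x v) w = H.ΩW.form x v (R.2 x w) := by
  have h1 : H.ΩW.adj R.2 = R.2 := congrArg Prod.snd h.adj_eq
  rw [← H.ΩW.form_adj, h1]

/-- The range of the projection onto a summand of constant rank. -/
def range (h : H.IsSummandProj R) {a b : ℕ}
    (ha : ∀ x, finrank ℂ (LinearMap.range (R.1 x)) = 2 * a)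
    (hb : ∀ x, finrank ℂ (LinearMap.range (R.2 x)) = 2 * b) : SymplecticPair H a b where
  V := h.holV.range (2 * a) ha
  W := h.holW.range (2 * b) hb
  invariant x t := by
    constructor
    · rintro _ ⟨w, rfl⟩
      exact ⟨_, (h.comm_β x t w).symm⟩
    · rintro _ ⟨w, rfl⟩
      exact ⟨_, (h.comm_γ x t w).symm⟩
  nondegV x v hv h0 := H.ΩV.nondegenerate x v fun w => by
    rw [← h.apply_fst hv, h.form_fst]
    exact h0 _ ⟨w, rfl⟩
  nondegW x v hv h0 := H.ΩW.nondegenerate x v fun w => by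
    rw [← h.apply_snd hv, h.form_snd]
    exact h0 _ ⟨w, rfl⟩
  rankV := rfl
  rankW := rfl

end IsSummandProj

end SpHiggs

end Restriction

section Decomposition

variable {X : Type u} [TopologicalSpace X] [ChartedSpace ℂ X]

/-! ### Direct sums from orthogonal idempotents -/

theorem HolSubbundle.bijective_sum_incl {A : HolBundle.{u, v} X} {ι : Type*} [Fintype ι]
    {E : ι → A.Endo} (hE : OrthogonalIdempotents E) (hs : ∑ i, E i = 1) {T : ι → HolSubbundle A}
    (hT : ∀ i x, (T i).fib x = LinearMap.range (E i x)) (x : X) :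
    Function.Bijective fun c : (∀ i, (T i).toBundle.Fib x) => ∑ i, (T i).incl x (c i) := by
  classical
  -- The idempotent `E i` is the identity on `T i` and vanishes on the other `T j`.
  have hmul : ∀ i j (c : (T j).toBundle.Fib x),
      E i x ((T j).incl x c) = if i = j then (T j).incl x c else 0 := by
    intro i j c
    obtain ⟨v, hv⟩ : (T j).incl x c ∈ LinearMap.range (E j x) := hT j x ▸ (T j).incl_mem c
    have h := LinearMap.congr_fun (congrFun (hE.mul_eq i j) x) v
    rw [← hv]
    split_ifs at h ⊢ with hij
    · rw [hij] at h ⊢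
      exact h
    · exact h
  constructor
  · intro c d hcd
    funext i
    refine (T i).incl_injective x ?_
    have := congrArg (E i x) hcd
    simpa [map_sum, hmul] using this
  · intro v
    refine ⟨fun i => (T i).retr x (E i x v), ?_⟩
    have h1 : ∀ i, (T i).incl x ((T i).retr x (E i x v)) = E i x v := fun i =>
      (T i).incl_retr (by rw [hT]; exact ⟨v, rfl⟩)
    simp only [h1]
    have h2 := LinearMap.congr_fun (congrFun hs x) v
    rwa [Finset.sum_apply, LinearMap.sum_apply] at h2

theorem SymplecticForm.form_sum_incl {A : HolBundle.{u, v} X} (Ω : SymplecticForm A) {ι : Type*}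
    [Fintype ι] {E : ι → A.Endo} (hE : OrthogonalIdempotents E) (hadj : ∀ i, Ω.adj (E i) = E i)
    {T : ι → HolSubbundle A} (hT : ∀ i x, (T i).fib x = LinearMap.range (E i x)) (x : X)
    (c d : ∀ i, (T i).toBundle.Fib x) :
    Ω.form x (∑ i, (T i).incl x (c i)) (∑ i, (T i).incl x (d i)) =
      ∑ i, Ω.form x ((T i).incl x (c i)) ((T i).incl x (d i)) := by
  have h0 : ∀ i j, i ≠ j → Ω.form x ((T i).incl x (c i)) ((T j).incl x (d j)) = 0 := by
    intro i j hij
    obtain ⟨v, hv⟩ : (T i).incl x (c i) ∈ LinearMap.range (E i x) := hT i x ▸ (T i).incl_mem _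
    obtain ⟨w, hw⟩ : (T j).incl x (d j) ∈ LinearMap.range (E j x) := hT j x ▸ (T j).incl_mem _
    have h : E i x (E j x w) = 0 := LinearMap.congr_fun (congrFun (hE.ortho hij) x) w
    rw [← hv, ← hw, ← Ω.form_adj, hadj, h, map_zero]
  simp only [map_sum, LinearMap.sum_apply]
  refine Finset.sum_congr rfl fun i _ => ?_
  exact Finset.sum_eq_single i (fun j _ hj => h0 j i hj) (by simp)

theorem projection_comm {M N : Type*} [AddCommGroup M] [Module ℂ M] [AddCommGroup N] [Module ℂ N]
    {S C : Submodule ℂ M} {S' C' : Submodule ℂ N} (h : IsCompl S C) (h' : IsCompl S' C')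
    (f : M →ₗ[ℂ] N) (hS : ∀ a ∈ S, f a ∈ S') (hC : ∀ a ∈ C, f a ∈ C') (v : M) :
    f (S.projection C h v) = S'.projection C' h' (f v) := by
  obtain ⟨a, ha, c, hc, rfl⟩ := Submodule.mem_sup.1
    (h.sup_eq_top.symm ▸ Submodule.mem_top : v ∈ S ⊔ C)
  rw [map_add, map_add, map_add, map_add, Submodule.projection_apply_of_mem_left _ ha,
    Submodule.projection_apply_of_mem_right _ hc,
    Submodule.projection_apply_of_mem_left _ (hS a ha),
    Submodule.projection_apply_of_mem_right _ (hC c hc), map_zero]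

/-! ### The double of an invariant isotropic pair -/

theorem SymplecticForm.IsIsotropicProj.incl_retr_doubleIncl {A : HolBundle.{u, v} X}
    {Ω : SymplecticForm A} {S : HolSubbundle A} {P : A.Endo} (h : Ω.IsIsotropicProj S P) (x : X)
    (T : HolSubbundle A) (hT : ∀ x, T.fib x = LinearMap.range (Ω.doubleProj P x))
    (c : (S.toBundle.prod S.toBundle.dual).Fib x) :
    T.incl x (T.retr x (Ω.doubleIncl S P x c)) = Ω.doubleIncl S P x c :=
  T.incl_retr (by rw [hT, ← h.range_doubleIncl]; exact ⟨c, rfl⟩)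

variable [IsManifold 𝓘(ℂ) ω X]

/-- The double of an isotropic subbundle is isomorphic to the range of the double projection. -/
def SymplecticForm.IsIsotropicProj.doubleIso {A : HolBundle.{u, v} X}
    {Ω : SymplecticForm A} {S : HolSubbundle A} {P : A.Endo} (h : Ω.IsIsotropicProj S P)
    (T : HolSubbundle A) (hT : ∀ x, T.fib x = LinearMap.range (Ω.doubleProj P x)) :
    HolIso (S.toBundle.prod S.toBundle.dual) T.toBundle where
  toHolHom := IsHolFamily.toHolHom (E := fun x => T.retr x ∘ₗ Ω.doubleIncl S P x)
    fun x₀ s hs => T.holAt_toBundle_iff.2 <| (h.isHolFamily_doubleIncl x₀ s hs).congr <|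
      Filter.Eventually.of_forall fun x => h.incl_retr_doubleIncl x T hT (s x)
  bijective x := by
    constructor
    · intro c d hcd
      refine h.doubleIncl_injective x ?_
      exact (h.incl_retr_doubleIncl x T hT c).symm.trans <|
        (congrArg (T.incl x) hcd).trans (h.incl_retr_doubleIncl x T hT d)
    · intro c
      have h1 := T.incl_mem c
      rw [hT, ← h.range_doubleIncl] at h1
      obtain ⟨d, hd⟩ := h1
      refine ⟨d, ?_⟩
      change T.retr x (Ω.doubleIncl S P x d) = c
      rw [hd, T.retr_incl]

namespace SpHiggs

variable {p q : ℕ} {H : SpHiggs.{u, v} X p q}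

variable (H) in
/-- The pair of double projections attached to a pair of isotropic projections. -/
def doubleProj (P : H.Endo) : H.Endo := P + H.adj P - P * H.adj P

variable (H) in
/-- `P` is a projection, compatible with the Higgs field, onto the isotropic pair `(S, T)`. -/
structure IsIsotropicProj (S : HolSubbundle H.V) (T : HolSubbundle H.W) (P : H.Endo) : Prop
    extends H.IsHiggsEndo P where
  V : H.ΩV.IsIsotropicProj S P.1
  W : H.ΩW.IsIsotropicProj T P.2

variable {S : HolSubbundle H.V} {T : HolSubbundle H.W} {P : H.Endo}

namespace IsIsotropicProj

theorem isSummandProj_doubleProj (h : H.IsIsotropicProj S T P) :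
    H.IsSummandProj (H.doubleProj P) where
  toIsHiggsEndo := (h.toIsHiggsEndo.add h.toIsHiggsEndo.adj).sub
    (h.toIsHiggsEndo.mul h.toIsHiggsEndo.adj)
  idem := Prod.ext h.V.doubleProj_mul_self h.W.doubleProj_mul_self
  adj_eq := Prod.ext (H.ΩV.adj_doubleProj P.1) (H.ΩW.adj_doubleProj P.2)

/-- The double of an invariant isotropic pair, as a symplectic pair. -/
def double (h : H.IsIsotropicProj S T P) : SymplecticPair H S.rank T.rank :=
  h.isSummandProj_doubleProj.range h.V.finrank_range_doubleProj h.W.finrank_range_doubleProj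

/-- The Higgs bundle of the double of an isotropic pair is induced by the restriction of `H` to
the pair, through `U(a,b) ⊆ Sp(2a,2b)`. -/
theorem induces_double (h : H.IsIsotropicProj S T P) (hinv : H.IsInvariant S T) :
    (H.toUHiggs.restrict S T hinv rfl rfl).Induces h.double.toSpHiggs := by
  have hV : ∀ x c, h.double.V.incl x (h.double.V.retr x (H.ΩV.doubleIncl S P.1 x c)) =
      H.ΩV.doubleIncl S P.1 x c := fun x c => h.V.incl_retr_doubleIncl x h.double.V (fun _ => rfl) c
  have hW : ∀ x c, h.double.W.incl x (h.double.W.retr x (H.ΩW.doubleIncl T P.2 x c)) =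
      H.ΩW.doubleIncl T P.2 x c := fun x c => h.W.incl_retr_doubleIncl x h.double.W (fun _ => rfl) c
  refine ⟨h.V.doubleIso h.double.V fun _ => rfl, h.W.doubleIso h.double.W fun _ => rfl,
    fun x (c d : (S.toBundle.prod S.toBundle.dual).Fib x) => ?_,
    fun x (c d : (T.toBundle.prod T.toBundle.dual).Fib x) => ?_,
    fun x t (c : (T.toBundle.prod T.toBundle.dual).Fib x) => ?_,
    fun x t (c : (S.toBundle.prod S.toBundle.dual).Fib x) => ?_⟩
  · change H.ΩV.form x (h.double.V.incl x (h.double.V.retr x (H.ΩV.doubleIncl S P.1 x c)))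
      (h.double.V.incl x (h.double.V.retr x (H.ΩV.doubleIncl S P.1 x d))) = _
    rw [hV, hV]
    exact h.V.form_doubleIncl x c d
  · change H.ΩW.form x (h.double.W.incl x (h.double.W.retr x (H.ΩW.doubleIncl T P.2 x c)))
      (h.double.W.incl x (h.double.W.retr x (H.ΩW.doubleIncl T P.2 x d))) = _
    rw [hW, hW]
    exact h.W.form_doubleIncl x c d
  · change h.double.V.retr x (H.β.toFun x t
      (h.double.W.incl x (h.double.W.retr x (H.ΩW.doubleIncl T P.2 x c)))) = _
    rw [hW]
    exact congrArg (h.double.V.retr x) (SymplecticForm.IsIsotropicProj.map_doubleIncl h.V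
      (H.β.toFun x t) (H.γ.toFun x t) (fun w a => H.skew x t w a) (h.comm_β x t)
      (h.comm_γ x t) (hinv x t).1 c)
  · change h.double.W.retr x (H.γ.toFun x t
      (h.double.V.incl x (h.double.V.retr x (H.ΩV.doubleIncl S P.1 x c)))) = _
    rw [hV]
    exact congrArg (h.double.W.retr x) (SymplecticForm.IsIsotropicProj.map_doubleIncl h.W
      (H.γ.toFun x t) (H.β.toFun x t) (fun a w => H.skew' x t a w) (h.comm_γ x t)
      (h.comm_β x t) (hinv x t).2 c)

end IsIsotropicProj

/-- An invariant isotropic pair in the range of the projection `R`, with an invariant complement,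
is the range of a projection that factors through `R`. -/
theorem IsSummandProj.exists_isIsotropicProj {R : H.Endo} (hR : H.IsSummandProj R)
    (hS : S.IsIsotropic H.ΩV) (hT : T.IsIsotropic H.ΩW) (hinv : H.IsInvariant S T)
    (hSR : ∀ x, S.fib x ≤ LinearMap.range (R.1 x)) (hTR : ∀ x, T.fib x ≤ LinearMap.range (R.2 x))
    {S' : HolSubbundle H.V} {T' : HolSubbundle H.W} (hinv' : H.IsInvariant S' T')
    (hSS : S.IsComplement S') (hTT : T.IsComplement T') :
    ∃ P, H.IsIsotropicProj S T P ∧ R * P = P ∧ P * R = P := by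
  -- `E` is the projection along the complement, and `P = E * R`.
  let E : H.Endo := (fun x => (S.fib x).projection (S'.fib x) (hSS x),
    fun x => (T.fib x).projection (T'.fib x) (hTT x))
  have hE : H.IsHiggsEndo E := ⟨hSS.isHolFamily_projection, hTT.isHolFamily_projection,
    fun x t w => projection_comm (hTT x) (hSS x) _ (hinv x t).1 (hinv' x t).1 w,
    fun x t w => projection_comm (hSS x) (hTT x) _ (hinv x t).2 (hinv' x t).2 w⟩
  have hER : H.IsHiggsEndo (E * R) := hE.mul hR.toIsHiggsEndo
  have hmemV : ∀ x v, (E * R).1 x v ∈ S.fib x := fun x v => Submodule.projection_apply_mem _ _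
  have hmemW : ∀ x v, (E * R).2 x v ∈ T.fib x := fun x v => Submodule.projection_apply_mem _ _
  refine ⟨E * R, ⟨hER, ⟨hER.holV, hmemV, fun x v hv => ?_, hS⟩,
    ⟨hER.holW, hmemW, fun x v hv => ?_, hT⟩⟩, Prod.ext ?_ ?_, ?_⟩
  · change E.1 x (R.1 x v) = v
    rw [hR.apply_fst (hSR x hv)]
    exact Submodule.projection_apply_of_mem_left _ hv
  · change E.2 x (R.2 x v) = v
    rw [hR.apply_snd (hTR x hv)]
    exact Submodule.projection_apply_of_mem_left _ hv
  · exact funext fun x => LinearMap.ext fun v => hR.apply_fst (hSR x (hmemV x v))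
  · exact funext fun x => LinearMap.ext fun v => hR.apply_snd (hTR x (hmemW x v))
  · rw [mul_assoc, hR.idem.eq]

/-! ### Pairs of degree zero -/

variable (H) in
/-- `(S, T)` is a nonzero invariant isotropic pair of degree `0` contained in the range of `R`. -/
structure IsZeroPair (R : H.Endo) (S : HolSubbundle H.V) (T : HolSubbundle H.W) : Prop where
  isotropicV : S.IsIsotropic H.ΩV
  isotropicW : T.IsIsotropic H.ΩW
  invariant : H.IsInvariant S T
  leV : ∀ x, S.fib x ≤ LinearMap.range (R.1 x)
  leW : ∀ x, T.fib x ≤ LinearMap.range (R.2 x)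
  rank_pos : 0 < S.rank + T.rank
  degree_eq : S.degree + T.degree = 0

/-- A summand that contains no isotropic pair of degree zero is stable. -/
theorem IsSummandProj.isStable_range {R : H.Endo} (hR : H.IsSummandProj R) (hH : H.IsSemistable)
    {a b : ℕ} (ha : ∀ x, finrank ℂ (LinearMap.range (R.1 x)) = 2 * a)
    (hb : ∀ x, finrank ℂ (LinearMap.range (R.2 x)) = 2 * b) (h : ∀ S T, ¬ H.IsZeroPair R S T) :
    (hR.range ha hb).toSpHiggs.IsStable := by
  intro (V' : HolSubbundle (hR.range ha hb).V.toBundle)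
    (W' : HolSubbundle (hR.range ha hb).W.toBundle) hV hW hinv hpos
  have hV' := HolSubbundle.IsIsotropic.push (h := (hR.range ha hb).nondegV) hV
  have hW' := HolSubbundle.IsIsotropic.push (h := (hR.range ha hb).nondegW) hW
  have hinv' := UHiggs.IsInvariant.push (h := (hR.range ha hb).invariant)
    (ha := (hR.range ha hb).rankV) (hb := (hR.range ha hb).rankW) hinv
  have hle := hH _ _ hV' hW' hinv'
  have hne : ((hR.range ha hb).V.push V').degree + ((hR.range ha hb).W.push W').degree ≠ 0 :=
    fun h0 => h _ _ ⟨hV', hW', hinv', HolSubbundle.push_le V', HolSubbundle.push_le W', hpos, h0⟩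
  have := lt_of_le_of_ne hle hne
  rwa [HolSubbundle.degree_push, HolSubbundle.degree_push] at this

/-- The restriction of `H` to an isotropic pair of degree zero and minimal rank is stable. -/
theorem IsZeroPair.isStable_restrict {R : H.Endo} (h : H.IsZeroPair R S T) (hH : H.IsSemistable)
    (hmin : ∀ S' T', H.IsZeroPair R S' T' → S.rank + T.rank ≤ S'.rank + T'.rank) :
    (H.toUHiggs.restrict S T h.invariant rfl rfl).IsStable ∧
      (H.toUHiggs.restrict S T h.invariant rfl rfl).degree = 0 := by
  have hdeg : (H.toUHiggs.restrict S T h.invariant rfl rfl).degree = 0 :=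
    (congrArg₂ (· + ·) S.degree_toBundle T.degree_toBundle).trans h.degree_eq
  refine ⟨fun (V' : HolSubbundle S.toBundle) (W' : HolSubbundle T.toBundle) hinv hpos hlt => ?_,
    hdeg⟩
  have hV : (S.push V').IsIsotropic H.ΩV := fun x a ha b hb =>
    h.isotropicV x a (HolSubbundle.push_le V' x ha) b (HolSubbundle.push_le V' x hb)
  have hW : (T.push W').IsIsotropic H.ΩW := fun x a ha b hb =>
    h.isotropicW x a (HolSubbundle.push_le W' x ha) b (HolSubbundle.push_le W' x hb)
  have hinv' := UHiggs.IsInvariant.push hinv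
  have hle := hH _ _ hV hW hinv'
  have hne : (S.push V').degree + (T.push W').degree ≠ 0 := fun h0 =>
    absurd (hmin _ _ ⟨hV, hW, hinv', fun x => (HolSubbundle.push_le V' x).trans (h.leV x),
      fun x => (HolSubbundle.push_le W' x).trans (h.leW x), hpos, h0⟩) (not_le.2 hlt)
  have h1 := lt_of_le_of_ne hle hne
  rw [HolSubbundle.degree_push, HolSubbundle.degree_push] at h1
  rw [hdeg, zero_mul]
  exact mul_neg_of_neg_of_pos h1 (by exact_mod_cast hpos.trans hlt)

/-! ### The decomposition -/

variable (H) in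
/-- `R` is the projection onto a nonzero orthogonal summand of `H` that is stable, or induced by
a stable `U(a,b)`-Higgs bundle of degree zero. -/
def IsStablePiece (R : H.Endo) : Prop :=
  H.IsSummandProj R ∧ ∃ (a b : ℕ) (N : SymplecticPair H a b),
    (∀ x, N.V.fib x = LinearMap.range (R.1 x)) ∧ (∀ x, N.W.fib x = LinearMap.range (R.2 x)) ∧
    0 < a + b ∧ (N.toSpHiggs.IsStable ∨
      ∃ U : UHiggs.{u, 0} X a b, U.IsStable ∧ U.degree = 0 ∧ U.Induces N.toSpHiggs)

theorem finrank_range_sub {M : Type*} [AddCommGroup M] [Module ℂ M] [FiniteDimensional ℂ M]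
    {R Q : End ℂ M} (hR : IsIdempotentElem R) (hQ : IsIdempotentElem Q)
    (hRQ : IsIdempotentElem (R - Q)) :
    finrank ℂ (LinearMap.range (R - Q)) + finrank ℂ (LinearMap.range Q) =
      finrank ℂ (LinearMap.range R) := by
  -- The trace of an idempotent is its rank, and the trace is additive.
  have key : ∀ E : End ℂ M, IsIdempotentElem E →
      LinearMap.trace ℂ M E = (finrank ℂ (LinearMap.range E) : ℂ) := fun E hE =>
    (LinearMap.IsIdempotentElem.isProj_range E hE).trace
  have h : (finrank ℂ (LinearMap.range (R - Q)) : ℂ) + finrank ℂ (LinearMap.range Q) =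
      finrank ℂ (LinearMap.range R) := by
    rw [← key _ hR, ← key _ hQ, ← key _ hRQ, map_sub, sub_add_cancel]
  exact_mod_cast h

theorem IsSummandProj.isIdempotentElem_fst {R : H.Endo} (h : H.IsSummandProj R) (x : X) :
    IsIdempotentElem (R.1 x) := congrFun (congrArg Prod.fst h.idem.eq) x

theorem IsSummandProj.isIdempotentElem_snd {R : H.Endo} (h : H.IsSummandProj R) (x : X) :
    IsIdempotentElem (R.2 x) := congrFun (congrArg Prod.snd h.idem.eq) x

/-- The main induction: a summand of a polystable Higgs bundle splits off the doubles of its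
isotropic pairs of degree zero and of minimal rank, until none is left. -/
theorem IsSummandProj.exists_orthogonalIdempotents [Nonempty X] (hH : H.IsPolystable) (n : ℕ) :
    ∀ {R : H.Endo}, H.IsSummandProj R → ∀ {a b : ℕ},
      (∀ x, finrank ℂ (LinearMap.range (R.1 x)) = 2 * a) →
      (∀ x, finrank ℂ (LinearMap.range (R.2 x)) = 2 * b) → a + b = n →
      ∃ (ι : Type) (_ : Fintype ι) (Q : ι → H.Endo), OrthogonalIdempotents Q ∧ ∑ i, Q i = R ∧
        ∀ i, H.IsStablePiece (Q i) := by
  induction n using Nat.strong_induction_on with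
  | _ n ih =>
  intro R hR a b ha hb hn
  obtain rfl | hpos := Nat.eq_zero_or_pos n
  · have hV : R.1 = 0 := funext fun x => LinearMap.range_eq_bot.1 <|
      Submodule.finrank_eq_zero.1 (by rw [ha]; omega)
    have hW : R.2 = 0 := funext fun x => LinearMap.range_eq_bot.1 <|
      Submodule.finrank_eq_zero.1 (by rw [hb]; omega)
    exact ⟨Empty, inferInstance, Empty.elim, ⟨fun i => i.elim, fun i => i.elim⟩,
      (Prod.ext hV hW).symm, fun i => i.elim⟩
  by_cases hex : ∃ S T, H.IsZeroPair R S T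
  · classical
    have hex' : ∃ k S T, H.IsZeroPair R S T ∧ S.rank + T.rank = k := by
      obtain ⟨S, T, h⟩ := hex
      exact ⟨_, S, T, h, rfl⟩
    obtain ⟨S, T, h, hk⟩ := Nat.find_spec hex'
    have hmin : ∀ S' T', H.IsZeroPair R S' T' → S.rank + T.rank ≤ S'.rank + T'.rank :=
      fun S' T' h' => hk ▸ Nat.find_min' hex' ⟨S', T', h', rfl⟩
    obtain ⟨S', T', -, -, hinv', hSS, hTT⟩ :=
      hH.2.1 S T h.isotropicV h.isotropicW h.invariant h.degree_eq
    obtain ⟨P, hP, hRP, hPR⟩ := hR.exists_isIsotropicProj h.isotropicV h.isotropicW h.invariant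
      h.leV h.leW hinv' hSS hTT
    obtain ⟨hstab, hdeg⟩ := h.isStable_restrict hH.1 hmin
    have hQ := hP.isSummandProj_doubleProj
    have hQR : H.doubleProj P * R = H.doubleProj P := Prod.ext
      (H.ΩV.doubleProj_mul_of_mul_eq (congrArg Prod.fst hR.adj_eq) (congrArg Prod.fst hRP)
        (congrArg Prod.fst hPR))
      (H.ΩW.doubleProj_mul_of_mul_eq (congrArg Prod.snd hR.adj_eq) (congrArg Prod.snd hRP)
        (congrArg Prod.snd hPR))
    have hRQ : R * H.doubleProj P = H.doubleProj P := Prod.ext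
      (H.ΩV.mul_doubleProj_of_mul_eq (congrArg Prod.fst hR.adj_eq) (congrArg Prod.fst hRP)
        (congrArg Prod.fst hPR))
      (H.ΩW.mul_doubleProj_of_mul_eq (congrArg Prod.snd hR.adj_eq) (congrArg Prod.snd hRP)
        (congrArg Prod.snd hPR))
    -- The remainder `R - Q` is a summand of smaller rank, orthogonal to `Q`.
    have hR' := hR.sub hQ hQR hRQ
    have ha' : ∀ x, finrank ℂ (LinearMap.range ((R - H.doubleProj P).1 x)) + 2 * S.rank = 2 * a :=
      fun x => by
        rw [← ha x, ← hP.V.finrank_range_doubleProj x]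
        exact finrank_range_sub (hR.isIdempotentElem_fst x) (hQ.isIdempotentElem_fst x)
          (hR'.isIdempotentElem_fst x)
    have hb' : ∀ x, finrank ℂ (LinearMap.range ((R - H.doubleProj P).2 x)) + 2 * T.rank = 2 * b :=
      fun x => by
        rw [← hb x, ← hP.W.finrank_range_doubleProj x]
        exact finrank_range_sub (hR.isIdempotentElem_snd x) (hQ.isIdempotentElem_snd x)
          (hR'.isIdempotentElem_snd x)
    have hrk := h.rank_pos
    obtain ⟨x⟩ := ‹Nonempty X›
    have hle1 : S.rank ≤ a := by have := ha' x; omega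
    have hle2 : T.rank ≤ b := by have := hb' x; omega
    obtain ⟨ι, hι, Q, hQo, hQs, hQp⟩ := ih (a - S.rank + (b - T.rank)) (by omega) hR'
      (a := a - S.rank) (b := b - T.rank) (fun x => by have := ha' x; omega)
      (fun x => by have := hb' x; omega) rfl
    refine ⟨Option ι, inferInstance, fun i => i.elim (H.doubleProj P) Q,
      hQo.option _ hQ.idem ?_ ?_, ?_, ?_⟩
    · rw [hQs, mul_sub, hQR, hQ.idem.eq, sub_self]
    · rw [hQs, sub_mul, hRQ, hQ.idem.eq, sub_self]
    · rw [Fintype.sum_option]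
      simp only [Option.elim_none, Option.elim_some, hQs]
      exact add_sub_cancel _ _
    · rintro (_ | i)
      · exact ⟨hQ, S.rank, T.rank, hP.double, fun _ => rfl, fun _ => rfl, hrk,
          Or.inr ⟨_, hstab, hdeg, hP.induces_double h.invariant⟩⟩
      · exact hQp i
  · refine ⟨Unit, inferInstance, fun _ => R, ⟨fun _ => hR.idem, fun i j hij => (hij rfl).elim⟩,
      by simp, fun _ => ⟨hR, a, b, hR.range ha hb, fun _ => rfl, fun _ => rfl, by omega,
      Or.inl (hR.isStable_range hH.1 ha hb fun S T h => hex ⟨S, T, h⟩)⟩⟩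

end SpHiggs

end Decomposition

end

end HiggsBundles

theorem mainTheorem7 {X : Type u} [TopologicalSpace X] [ChartedSpace ℂ X] [IsManifold 𝓘(ℂ) ω X]
    [CompactSpace X] [ConnectedSpace X] [T2Space X] {p q : ℕ}
    (H : HiggsBundles.SpHiggs.{u, v} X p q) (hH : H.IsPolystable) :
    ∃ (N : ℕ) (a b : Fin N → ℕ) (G : ∀ i, HiggsBundles.SpHiggs.{u, 0} X (a i) (b i)),
      H.IsDirectSum G ∧
      ∀ i, 0 < a i + b i ∧
        ((a i ≤ p ∧ b i ≤ q ∧ (G i).IsStable) ∨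
          (a i ≤ p ∧ b i ≤ q ∧ ∃ U : HiggsBundles.UHiggs.{u, 0} X (a i) (b i),
            U.IsStable ∧ U.degree = 0 ∧ U.Induces (G i)) ∨
          (∃ (n : ℕ) (F : HiggsBundles.CompactSpHiggs.{u, 0} X n),
            n ≤ p + q ∧ F.IsStable ∧ F.Induces (G i)) ∨
          (∃ (n : ℕ) (F : HiggsBundles.CompactUHiggs.{u, 0} X n),
            n ≤ p + q ∧ F.IsStable ∧ F.E.degree = 0 ∧ F.Induces (G i))) := by
  obtain ⟨ι, hι, Q, hQ, hs, hpiece⟩ :=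
    HiggsBundles.SpHiggs.IsSummandProj.exists_orthogonalIdempotents hH (p + q)
      (HiggsBundles.SpHiggs.IsSummandProj.one (H := H)) (a := p) (b := q)
      (fun x => by
        refine (congrArg (fun S : Submodule ℂ (H.V.Fib x) => finrank ℂ S)
          LinearMap.range_id).trans ?_
        rw [finrank_top, H.V.finrank_fib, H.rankV])
      (fun x => by
        refine (congrArg (fun S : Submodule ℂ (H.W.Fib x) => finrank ℂ S)
          LinearMap.range_id).trans ?_
        rw [finrank_top, H.W.finrank_fib, H.rankW]) rfl
  let e := (Fintype.equivFin ι).symm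
  choose hproj a b n hV hW hpos hst using fun i => hpiece (e i)
  have hE : OrthogonalIdempotents fun i => Q (e i) := (OrthogonalIdempotents.equiv e).2 hQ
  have hsum : ∑ i, Q (e i) = 1 := (e.sum_comp Q).trans hs
  have hEV : OrthogonalIdempotents fun i => (Q (e i)).1 :=
    hE.map (RingHom.fst H.V.Endo H.W.Endo)
  have hEW : OrthogonalIdempotents fun i => (Q (e i)).2 :=
    hE.map (RingHom.snd H.V.Endo H.W.Endo)
  refine ⟨Fintype.card ι, a, b, fun i => (n i).toSpHiggs,
    ⟨fun i => ((n i).V.isHolFamily_incl).toHolHom, fun i => ((n i).W.isHolFamily_incl).toHolHom,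
      HiggsBundles.HolSubbundle.bijective_sum_incl hEV
        (by rw [← Prod.fst_sum, hsum]; rfl) hV,
      HiggsBundles.HolSubbundle.bijective_sum_incl hEW
        (by rw [← Prod.snd_sum, hsum]; rfl) hW,
      H.ΩV.form_sum_incl hEV (fun i => congrArg Prod.fst (hproj i).adj_eq) hV,
      H.ΩW.form_sum_incl hEW (fun i => congrArg Prod.snd (hproj i).adj_eq) hW,
      fun x t i c => (H.incl_restrict_β (n i).invariant (n i).rankV (n i).rankW x t c).symm,
      fun x t i c => (H.incl_restrict_γ (n i).invariant (n i).rankV (n i).rankW x t c).symm⟩,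
    fun i => ⟨hpos i, ?_⟩⟩
  have ha : a i ≤ p := by
    have h1 := (n i).V.rank_le
    have h2 := (n i).rankV
    have h3 := H.rankV
    omega
  have hb : b i ≤ q := by
    have h1 := (n i).W.rank_le
    have h2 := (n i).rankW
    have h3 := H.rankW
    omega
  exact (hst i).elim (fun h => Or.inl ⟨ha, hb, h⟩) fun h => Or.inr (Or.inl ⟨ha, hb, h⟩)
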